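/- Let $k$ be a complete valuation field, i.e. a field with a multiplicative ultrametric absolute value $|\cdot|\colon k\to\mathbb R_{\ge 0}$ (possibly trivial) for which $k$ is complete, and let $O_k=\{c\in k : |c|\le 1\}$. A Banach $k$-vector space is a $k$-vector space $V$ which is complete for an ultrametric norm $\|\cdot\|$ satisfying $\|cv\|=|c|\,\|v\|$ for all $c\in k$, $v\in V$. For $S\subset V$ let $\langle S\rangle$ be the closure of the $k$-linear span of $S$, and let $\mathrm{rank}(V)$ be the least cardinality of a subset $S\subset V$ with $\langle S\rangle=V$. For a set $E$, let $C_0(E,k)$ be the set of maps $c\colon E\to k$ such that $\{e\in E : |c(e)|\ge\epsilon\}$ is finite for every $\epsilon>0$, with the norm $\|c\|=\sup_{e\in E}|c(e)|$ (which is $0$ if $E=\emptyset$). A subset $E\subset V$ is an orthonormal Schauder basis of $V$ if (1) $\|e\|=1$ for every $e\in E$; (2) $\bigl\|\sum_{e\in E}c(e)e\bigr\|=\|c\|$ for every $c\in C_0(E,k)$; and (3) every $v\in V$ is of the form $\sum_{e\in E}c(e)e$ for some $c\in C_0(E,k)$. The space $V$ is free if it admits an orthonormal Schauder basis, and is almost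 free if $\langle S\rangle$ (with the restricted norm) is free for every $S\subset V$ with $\#S<\mathrm{rank}(V)$. A filter (always assumed proper) is $\lambda$-complete, for a cardinal $\lambda$, if it is closed under intersections of non-empty families of fewer than $\lambda$ of its members. A cardinal $\kappa$ is $\lambda$-strongly compact if $\kappa\ge\lambda$ and every $\kappa$-complete filter on $\kappa$ is contained in a $\lambda$-complete ultrafilter on $\kappa$. Let $\lambda_k$ be the successor cardinal of $\max\{\#(k/O_k),\aleph_0\}$, where $k/O_k$ is the quotient of additive groups. **Theorem.** Let $V$ be a Banach $k$-vector space with $\#V=\mathrm{rank}(V)$, and suppose that $\mathrm{rank}(V)$ is $\lambda_k$-strongly compact. Then $V$ is free if and only if $V$ is almost free. -/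

import Mathlib

/-
A complete valuation field `k` is a complete ultrametric `NormedField` (the trivial valuation is
allowed), and a Banach `k`-vector space is a complete ultrametric normed `k`-vector space.
-/

open Filter Topology Cardinal

universe u v w

namespace UltraBanach

/-- The valuation ring `O_k = {c | |c| ≤ 1}`, as an additive subgroup of `k`. -/
def integers (k : Type u) [NormedField k] [IsUltrametricDist k] : AddSubgroup k where
  carrier := {c | ‖c‖ ≤ 1}
  zero_mem' := by simp
  add_mem' := fun {a b} ha hb =>
    (IsUltrametricDist.norm_add_le_max a b).trans (max_le ha hb)
  neg_mem' := fun {a} ha => by simpa using ha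

/-- `λ_k`, the successor cardinal of `max {#(k / O_k), ℵ₀}`; here `k / O_k` is the quotient of
additive groups (not the residue field). -/
noncomputable def lambdaCard (k : Type u) [NormedField k] [IsUltrametricDist k] : Cardinal.{u} :=
  Order.succ (max #(k ⧸ integers k) ℵ₀)

/-- `κ` is `lam`-strongly compact: `lam ≤ κ`, and every `κ`-complete (proper) filter on a set of
cardinality `κ` is contained in a `lam`-complete ultrafilter. `CardinalInterFilter F c` says that
`F` is closed under intersections of fewer than `c` members. -/
def IsStronglyCompactCard (lam κ : Cardinal.{w}) : Prop :=
  lam ≤ κ ∧ ∀ (X : Type w), #X = κ → ∀ F : Filter X, F.NeBot → CardinalInterFilter F κ →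
    ∃ U : Ultrafilter X, CardinalInterFilter (U : Filter X) lam ∧ (U : Filter X) ≤ F

section Spaces

variable (k : Type u) [NormedField k] (V : Type v) [NormedAddCommGroup V] [NormedSpace k V]

/-- `⟨S⟩`, the closure of the linear subspace generated by `S`. -/
def closedSpan {k : Type u} [NormedField k] {V : Type v} [NormedAddCommGroup V]
    [NormedSpace k V] (S : Set V) : Submodule k V :=
  (Submodule.span k S).topologicalClosure

/-- `rank V`, the least cardinality of a subset of `V` topologically generating `V`. -/
noncomputable def rank : Cardinal.{v} :=
  sInf {c : Cardinal.{v} | ∃ S : Set V, closedSpan (k := k) S = ⊤ ∧ #S = c}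

variable {V} in
/-- `E` is an orthonormal Schauder basis of `V`. The elements of `C₀(E, k)` are the families
`c : E → k` tending to `0` along the cofinite filter, and the norm of `c` is `⨆ e, ‖c e‖`. -/
structure IsOrthonormalSchauderBasis (E : Set V) : Prop where
  norm_eq_one : ∀ e ∈ E, ‖e‖ = 1
  norm_sum : ∀ c : E → k, Tendsto c cofinite (𝓝 0) →
    ∃ s : V, HasSum (fun e : E => c e • (e : V)) s ∧ ‖s‖ = ⨆ e : E, ‖c e‖
  exists_sum : ∀ x : V, ∃ c : E → k, Tendsto c cofinite (𝓝 0) ∧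
    HasSum (fun e : E => c e • (e : V)) x

/-- `V` is free: it admits an orthonormal Schauder basis. -/
def IsFree : Prop :=
  ∃ E : Set V, IsOrthonormalSchauderBasis k E

/-- `V` is `κ`-free: `⟨S⟩` is free for every subset `S` of `V` of cardinality `< κ`. -/
def IsCardFree (κ : Cardinal.{v}) : Prop :=
  ∀ S : Set V, #S < κ → IsFree k (closedSpan (k := k) S)

/-- `V` is almost free: it is `rank V`-free. -/
def IsAlmostFree : Prop :=
  IsCardFree k V (rank k V)

end Spaces

end UltraBanach

/-
Suppose first that the valuation is nontrivial. If `B` embeds isometrically, modulo the closed span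
of an orthonormal set `T`, into some `C₀(I, k)`, then `T` extends to an orthonormal basis of `B`:
this is a relative form of Gruson's theorem that closed subspaces of free spaces are free.

If the rank `κ` is regular, `V` is the union of the free spaces `⟨A⟩` generated by fewer than `κ`
members of a fixed generating set. Strong compactness provides a `λ_k`-complete ultrafilter on the
index set of these spaces which eventually contains every generator. As a function with values in
`k / O_k` is constant along such an ultrafilter, scalars have limits along it, so the coordinate
forms of the spaces `⟨A⟩` have limits, and these embed `V` isometrically into some `C₀(I, k)`.

If `κ` is singular, Shelah's singular compactness argument applies. By a closing-off argument, each
small set lies in a subspace which is saturated at its cardinality: modulo it, all extensions by few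
generators embed into some `C₀(I, k)`. Extending relative bases in countably many rounds
produces `cof κ` orthonormal sets with dense union of spans, each of which contains bases of the
spans of the previous ones, and these assemble to a basis of `V`.

For the trivial valuation freeness means that all nonzero vectors have norm `1`, which is tested on
single vectors.
-/

namespace UltraBanach

section ClosedSpan

variable {k : Type u} [NormedField k] {V : Type v} [NormedAddCommGroup V] [NormedSpace k V]

theorem span_le_closedSpan (S : Set V) : Submodule.span k S ≤ closedSpan (k := k) S :=
  Submodule.le_topologicalClosure _

theorem subset_closedSpan (S : Set V) : S ⊆ closedSpan (k := k) S :=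
  Submodule.subset_span.trans (span_le_closedSpan S)

theorem isClosed_closedSpan (S : Set V) : IsClosed (closedSpan (k := k) S : Set V) :=
  Submodule.isClosed_topologicalClosure _

theorem closedSpan_le {S : Set V} {A : Submodule k V} (hA : IsClosed (A : Set V)) (h : S ⊆ A) :
    closedSpan (k := k) S ≤ A :=
  Submodule.topologicalClosure_minimal _ (Submodule.span_le.2 h) hA

theorem closedSpan_le_closedSpan {S T : Set V} (h : S ⊆ closedSpan (k := k) T) :
    closedSpan (k := k) S ≤ closedSpan (k := k) T :=
  closedSpan_le (isClosed_closedSpan T) h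

theorem closedSpan_mono {S T : Set V} (h : S ⊆ T) :
    closedSpan (k := k) S ≤ closedSpan (k := k) T :=
  closedSpan_le_closedSpan (h.trans (subset_closedSpan T))

theorem mem_closedSpan_iff {S : Set V} {x : V} :
    x ∈ closedSpan (k := k) S ↔ ∀ ε > 0, ∃ y ∈ Submodule.span k S, ‖x - y‖ < ε := by
  rw [closedSpan, ← SetLike.mem_coe, Submodule.topologicalClosure_coe, Metric.mem_closure_iff]
  simp only [dist_eq_norm, SetLike.mem_coe]

theorem mem_span_iff_linearCombination {S : Set V} {x : V} :
    x ∈ Submodule.span k S ↔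
      ∃ l ∈ Finsupp.supported k k S, Finsupp.linearCombination k id l = x := by
  rw [← Finsupp.mem_span_image_iff_linearCombination, Set.image_id]

theorem exists_countable_mem_closedSpan {S : Set V} {x : V} (hx : x ∈ closedSpan (k := k) S) :
    ∃ C ⊆ S, C.Countable ∧ x ∈ closedSpan (k := k) C := by
  have happrox : ∀ n : ℕ, ∃ F : Finset V, (F : Set V) ⊆ S ∧
      ∃ y ∈ Submodule.span k (F : Set V), ‖x - y‖ < 1 / ((n : ℝ) + 1) := by
    intro n
    obtain ⟨y, hy, hxy⟩ := mem_closedSpan_iff.1 hx _ (Nat.one_div_pos_of_nat (α := ℝ) (n := n))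
    obtain ⟨F, hF, hyF⟩ := Submodule.mem_span_finite_of_mem_span hy
    exact ⟨F, hF, y, hyF, hxy⟩
  choose F hFS y hy hxy using happrox
  refine ⟨⋃ n, (F n : Set V), Set.iUnion_subset hFS,
    Set.countable_iUnion fun n => (F n).countable_toSet, mem_closedSpan_iff.2 fun ε hε => ?_⟩
  obtain ⟨n, hn⟩ := exists_nat_one_div_lt hε
  exact ⟨y n, Submodule.span_mono (Set.subset_iUnion (fun n => (F n : Set V)) n) (hy n),
    (hxy n).trans hn⟩

theorem isClosed_inf_ker {B : Submodule k V} (hB : IsClosed (B : Set V)) {f : V →ₗ[k] k}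
    (hf : ∀ x ∈ B, ‖f x‖ ≤ ‖x‖) : IsClosed ((B ⊓ LinearMap.ker f : Submodule k V) : Set V) := by
  have hcont : Continuous (f ∘ₗ B.subtype) :=
    AddMonoidHomClass.continuous_of_bound (f ∘ₗ B.subtype) 1 fun x => by simpa using hf x x.2
  have heq : ((B ⊓ LinearMap.ker f : Submodule k V) : Set V) =
      (↑) '' ((f ∘ₗ B.subtype) ⁻¹' {0}) := by
    ext x
    simp [and_comm]
  rw [heq]
  exact hB.isClosedEmbedding_subtypeVal.isClosedMap _ (isClosed_singleton.preimage hcont)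

end ClosedSpan

section Ultrametric

variable {V : Type v} [NormedAddCommGroup V] [IsUltrametricDist V]

theorem norm_add_le_of_le {x y : V} {r : ℝ} (hx : ‖x‖ ≤ r) (hy : ‖y‖ ≤ r) : ‖x + y‖ ≤ r :=
  (IsUltrametricDist.norm_add_le_max x y).trans (max_le hx hy)

theorem norm_sub_le_of_le {x y : V} {r : ℝ} (hx : ‖x‖ ≤ r) (hy : ‖y‖ ≤ r) : ‖x - y‖ ≤ r := by
  simpa [sub_eq_add_neg] using norm_add_le_of_le hx ((norm_neg y).trans_le hy)

theorem norm_le_of_hasSum {I : Type w} {f : I → V} {x : V} (hx : HasSum f x) {r : ℝ} (hr : 0 ≤ r)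
    (h : ∀ i, ‖f i‖ ≤ r) : ‖x‖ ≤ r :=
  le_of_tendsto hx.norm (Eventually.of_forall fun _ =>
    IsUltrametricDist.norm_sum_le_of_forall_le_of_nonneg hr fun i _ => h i)

end Ultrametric

section OrthonormalSet

variable {k : Type u} [NormedField k] {V : Type v} [NormedAddCommGroup V] [NormedSpace k V]

variable (k) in
/-- An orthonormal set in the non-archimedean sense: finite linear combinations of its vectors
have the sup norm of their coefficients. Only the nontrivial inequality is required. -/
structure IsOrthonormalSet (T : Set V) : Prop where
  norm_eq_one : ∀ e ∈ T, ‖e‖ = 1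
  norm_apply_le : ∀ l ∈ Finsupp.supported k k T, ∀ e,
    ‖l e‖ ≤ ‖Finsupp.linearCombination k id l‖

namespace IsOrthonormalSet

variable {T T₁ T₂ : Set V}

theorem empty : IsOrthonormalSet k (∅ : Set V) where
  norm_eq_one _ he := he.elim
  norm_apply_le l hl e := by simp_all

theorem mono (hT : IsOrthonormalSet k T) (h : T₁ ⊆ T) : IsOrthonormalSet k T₁ where
  norm_eq_one e he := hT.norm_eq_one e (h he)
  norm_apply_le l hl := hT.norm_apply_le l (Finsupp.supported_mono h hl)

theorem iUnion {ι : Sort*} [Nonempty ι] {T : ι → Set V} (hdir : Directed (· ⊆ ·) T)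
    (hT : ∀ i, IsOrthonormalSet k (T i)) : IsOrthonormalSet k (⋃ i, T i) where
  norm_eq_one e he := by
    obtain ⟨i, hi⟩ := Set.mem_iUnion.1 he
    exact (hT i).norm_eq_one e hi
  norm_apply_le l hl := by
    obtain ⟨i, hi⟩ := hdir.directedOn_range.exists_mem_subset_of_finite_of_subset_sUnion
      (Set.range_nonempty T) l.support.finite_toSet (by rwa [Set.sUnion_range])
    obtain ⟨⟨i, rfl⟩, hi⟩ := hi
    exact (hT i).norm_apply_le l hi

theorem singleton {t : V} (ht : ‖t‖ = 1) : IsOrthonormalSet k {t} where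
  norm_eq_one _ he := by rwa [Set.mem_singleton_iff.1 he]
  norm_apply_le l hl e := by
    obtain ⟨c, rfl⟩ : ∃ c, l = Finsupp.single t c :=
      ⟨l t, Finsupp.support_subset_singleton.1 fun x hx => Finset.mem_singleton.2 (hl hx)⟩
    by_cases he : e = t <;> simp [he, norm_smul, ht]

variable [IsUltrametricDist V]

theorem union (hT₁ : IsOrthonormalSet k T₁) (hT₂ : IsOrthonormalSet k T₂)
    (h : ∀ y ∈ Submodule.span k T₁, ∀ z ∈ Submodule.span k T₂, ‖z‖ ≤ ‖y + z‖) :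
    IsOrthonormalSet k (T₁ ∪ T₂) where
  norm_eq_one e he := he.elim (hT₁.norm_eq_one e) (hT₂.norm_eq_one e)
  norm_apply_le l hl e := by
    classical
    set l₁ := l.filter (· ∈ T₁)
    set l₂ := l.filter (· ∉ T₁)
    have hl₁ : l₁ ∈ Finsupp.supported k k T₁ := fun x hx => by simp_all [l₁]
    have hl₂ : l₂ ∈ Finsupp.supported k k T₂ := fun x hx => by
      have := @hl x
      simp_all [l₂]
    have hadd : l₁ + l₂ = l := Finsupp.filter_add_filter_not l _
    have hle := h _ (mem_span_iff_linearCombination.2 ⟨l₁, hl₁, rfl⟩) _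
      (mem_span_iff_linearCombination.2 ⟨l₂, hl₂, rfl⟩)
    rw [← map_add, hadd] at hle
    by_cases he : e ∈ T₁
    · have hle₁ : ‖Finsupp.linearCombination k id l₁‖ ≤ ‖Finsupp.linearCombination k id l‖ := by
        simpa [← map_sub, ← hadd] using norm_sub_le_of_le le_rfl hle
      rw [← Finsupp.filter_apply_pos (· ∈ T₁) l he]
      exact (hT₁.norm_apply_le l₁ hl₁ e).trans hle₁
    · rw [← Finsupp.filter_apply_pos (· ∉ T₁) l he]
      exact (hT₂.norm_apply_le l₂ hl₂ e).trans hle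

theorem insert (hT : IsOrthonormalSet k T) {t : V} (ht : ‖t‖ = 1)
    (h : ∀ y ∈ Submodule.span k T, ∀ c : k, ‖c‖ ≤ ‖y + c • t‖) :
    IsOrthonormalSet k (insert t T) := by
  rw [Set.insert_eq, Set.union_comm]
  refine hT.union (singleton ht) fun y hy z hz => ?_
  obtain ⟨c, rfl⟩ := Submodule.mem_span_singleton.1 hz
  rw [norm_smul, ht, mul_one]
  exact h y hy c

theorem norm_linearCombination_le (hT : IsOrthonormalSet k T) {l : V →₀ k}
    (hl : l ∈ Finsupp.supported k k T) {r : ℝ} (hr : 0 ≤ r) (h : ∀ e ∈ T, ‖l e‖ ≤ r) :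
    ‖Finsupp.linearCombination k id l‖ ≤ r := by
  refine IsUltrametricDist.norm_sum_le_of_forall_le_of_nonneg hr fun e he => ?_
  change ‖l e • e‖ ≤ r
  simpa [norm_smul, hT.norm_eq_one e (hl he)] using h e (hl he)

theorem norm_le_norm_add_of_disjoint (hT : IsOrthonormalSet k T) (h₁ : T₁ ⊆ T) (h₂ : T₂ ⊆ T)
    (hd : Disjoint T₁ T₂) {y z : V} (hy : y ∈ closedSpan (k := k) T₁)
    (hz : z ∈ Submodule.span k T₂) : ‖z‖ ≤ ‖y + z‖ := by
  refine closure_minimal (s := Submodule.span k T₁) (t := {y : V | ‖z‖ ≤ ‖y + z‖}) (fun y hy => ?_)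
    (isClosed_le continuous_const (by fun_prop)) (by rwa [← Submodule.topologicalClosure_coe])
  obtain ⟨l, hl, rfl⟩ := mem_span_iff_linearCombination.1 hy
  obtain ⟨m, hm, rfl⟩ := mem_span_iff_linearCombination.1 hz
  refine (hT.mono h₂).norm_linearCombination_le hm (norm_nonneg _) fun e he => ?_
  have hle : l e = 0 := (Finsupp.mem_supported' k l).1 hl e (hd.notMem_of_mem_right he)
  rw [← map_add]
  simpa [hle] using hT.norm_apply_le (l + m) (Submodule.add_mem _
    (Finsupp.supported_mono h₁ hl) (Finsupp.supported_mono h₂ hm)) e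

theorem iUnion_of_orthogonal {ι : Type*} [LinearOrder ι] {D : ι → Set V}
    (hD : ∀ i, IsOrthonormalSet k (D i))
    (horth : ∀ i, ∀ y ∈ Submodule.span k (⋃ j < i, D j), ∀ z ∈ Submodule.span k (D i),
      ‖z‖ ≤ ‖y + z‖) : IsOrthonormalSet k (⋃ i, D i) := by
  rw [Set.iUnion_eq_iUnion_finset]
  refine iUnion ((Monotone.directed_le fun F G hFG => Set.biUnion_subset_biUnion_left hFG))
    fun F => ?_
  induction F using Finset.induction_on_max with
  | empty => simpa using empty
  | insert i F hlt ih =>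
    rw [Finset.set_biUnion_insert, Set.union_comm]
    exact ih.union (hD i) fun y hy => horth i y
      (Submodule.span_mono (Set.biUnion_subset_biUnion_left fun j hj => hlt j hj) hy)

end IsOrthonormalSet

end OrthonormalSet

section Coord

variable {k : Type u} [NormedField k] {V : Type v} [NormedAddCommGroup V] [NormedSpace k V]
  {T : Set V}

theorem exists_linearMap_extend_of_norm_le [CompleteSpace k] {E : Type*} [AddCommGroup E]
    [Module k E] {f : E →ₗ[k] k} {g : E →ₗ[k] V} (h : ∀ x, ‖f x‖ ≤ ‖g x‖) :
    ∃ F : V →ₗ[k] k, (∀ x, F (g x) = f x) ∧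
      ∀ y ∈ (LinearMap.range g).topologicalClosure, ‖F y‖ ≤ ‖y‖ := by
  set W := (LinearMap.range g).topologicalClosure
  let g' : E →ₗ[k] W := g.codRestrict W fun x =>
    Submodule.le_topologicalClosure _ (LinearMap.mem_range_self g x)
  have hdense : DenseRange g' := by
    refine Metric.denseRange_iff.2 fun y ε hε => ?_
    obtain ⟨_, ⟨x, rfl⟩, hx⟩ := Metric.mem_closure_iff.1 y.2 ε hε
    exact ⟨x, hx⟩
  have hbound : ∀ x, ‖f x‖ ≤ 1 * ‖g' x‖ := fun x => (one_mul ‖g' x‖).symm ▸ h x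
  obtain ⟨F, hF⟩ := LinearMap.exists_extend (f.extendOfNorm g').toLinearMap
  have hFW : ∀ y : W, F y = f.extendOfNorm g' y := LinearMap.congr_fun hF
  refine ⟨F, fun x => ?_, fun y hy => ?_⟩
  · exact (hFW (g' x)).trans (LinearMap.extendOfNorm_eq hdense ⟨1, hbound⟩ x)
  · rw [hFW ⟨y, hy⟩]
    simpa using LinearMap.norm_extendOfNorm_apply_le hdense 1 hbound ⟨y, hy⟩

namespace IsOrthonormalSet

variable [CompleteSpace k]

theorem exists_coord (hT : IsOrthonormalSet k T) (e : V) : ∃ f : V →ₗ[k] k,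
    (∀ l ∈ Finsupp.supported k k T, f (Finsupp.linearCombination k id l) = l e) ∧
      ∀ x ∈ closedSpan (k := k) T, ‖f x‖ ≤ ‖x‖ := by
  obtain ⟨f, hf, hf'⟩ := exists_linearMap_extend_of_norm_le
    (E := Finsupp.supported k k T) (f := Finsupp.lapply e ∘ₗ (Finsupp.supported k k T).subtype)
    (g := Finsupp.linearCombination k (id : V → V) ∘ₗ (Finsupp.supported k k T).subtype)
    fun l : Finsupp.supported k k T => hT.norm_apply_le (l : V →₀ k) l.2 e
  refine ⟨f, fun l hl => hf ⟨l, hl⟩, fun x hx => hf' x ?_⟩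
  rwa [LinearMap.range_comp, Submodule.range_subtype, ← Finsupp.span_image_eq_map_linearCombination,
    Set.image_id]

/-- The coordinate of vectors of `⟨T⟩` along `e`, for an orthonormal set `T`. It is extended to a
linear form on the whole space, but only its values on `⟨T⟩` are meaningful; it vanishes there
when `e ∉ T`. -/
noncomputable def coord (hT : IsOrthonormalSet k T) (e : V) : V →ₗ[k] k :=
  (hT.exists_coord e).choose

theorem coord_linearCombination (hT : IsOrthonormalSet k T) (e : V) {l : V →₀ k}
    (hl : l ∈ Finsupp.supported k k T) :
    hT.coord e (Finsupp.linearCombination k id l) = l e :=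
  (hT.exists_coord e).choose_spec.1 l hl

theorem norm_coord_le (hT : IsOrthonormalSet k T) (e : V) {x : V}
    (hx : x ∈ closedSpan (k := k) T) : ‖hT.coord e x‖ ≤ ‖x‖ :=
  (hT.exists_coord e).choose_spec.2 x hx

theorem tendsto_coord (hT : IsOrthonormalSet k T) {x : V} (hx : x ∈ closedSpan (k := k) T) :
    Tendsto (fun e => hT.coord e x) cofinite (𝓝 0) := by
  refine Metric.tendsto_nhds.2 fun ε hε => ?_
  obtain ⟨y, hy, hxy⟩ := mem_closedSpan_iff.1 hx ε hε
  have hxy' := Submodule.sub_mem _ hx (span_le_closedSpan T hy)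
  obtain ⟨l, hl, rfl⟩ := mem_span_iff_linearCombination.1 hy
  filter_upwards [l.support.finite_toSet.compl_mem_cofinite] with e he
  have hle : l e = 0 := by simpa using he
  have := (hT.norm_coord_le e hxy').trans_lt hxy
  rwa [map_sub, hT.coord_linearCombination e hl, hle, sub_zero, ← dist_zero_right] at this

theorem coord_eq_zero_of_subset (hT : IsOrthonormalSet k T) {T₁ : Set V} (h : T₁ ⊆ T) {e : V}
    (he : e ∉ T₁) {x : V} (hx : x ∈ closedSpan (k := k) T₁) : hT.coord e x = 0 := by
  have hclosed := isClosed_inf_ker (isClosed_closedSpan (k := k) T) fun x hx =>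
    hT.norm_coord_le e hx
  refine (closedSpan_le hclosed (fun t ht => ⟨subset_closedSpan T (h ht), ?_⟩) hx).2
  have hne : t ≠ e := fun hte => he (hte ▸ ht)
  simpa [hne] using hT.coord_linearCombination e (Finsupp.single_mem_supported k (1 : k) (h ht))

theorem norm_coord_smul (hT : IsOrthonormalSet k T) (e : V) {x : V}
    (hx : x ∈ closedSpan (k := k) T) : ‖hT.coord e x • e‖ = ‖hT.coord e x‖ := by
  by_cases he : e ∈ T
  · rw [norm_smul, hT.norm_eq_one e he, mul_one]
  · rw [hT.coord_eq_zero_of_subset subset_rfl he hx, zero_smul, norm_zero, norm_zero]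

theorem hasSum_coord_smul [IsUltrametricDist V] (hT : IsOrthonormalSet k T) {x : V}
    (hx : x ∈ closedSpan (k := k) T) : HasSum (fun e => hT.coord e x • e) x := by
  refine Metric.tendsto_nhds.2 fun ε hε => ?_
  obtain ⟨y, hy, hxy⟩ := mem_closedSpan_iff.1 hx (ε / 2) (half_pos hε)
  have hxy' := Submodule.sub_mem _ hx (span_le_closedSpan T hy)
  obtain ⟨l, hl, rfl⟩ := mem_span_iff_linearCombination.1 hy
  filter_upwards [eventually_ge_atTop l.support] with F hF
  have hsum : ∑ e ∈ F, hT.coord e (Finsupp.linearCombination k id l) • e =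
      Finsupp.linearCombination k id l := by
    simp only [hT.coord_linearCombination _ hl]
    exact (Finsupp.sum_of_support_subset l hF (fun e c => c • e) (by simp)).symm
  have hsplit : ∑ e ∈ F, hT.coord e x • e - x =
      ∑ e ∈ F, hT.coord e (x - Finsupp.linearCombination k id l) • e -
        (x - Finsupp.linearCombination k id l) := by
    simp only [map_sub, sub_smul, Finset.sum_sub_distrib, hsum, sub_sub_sub_cancel_right]
  rw [dist_eq_norm, hsplit]
  refine (norm_sub_le_of_le ?_ le_rfl).trans_lt (hxy.trans (half_lt_self hε))
  refine IsUltrametricDist.norm_sum_le_of_forall_le_of_nonneg (norm_nonneg _) fun e _ => ?_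
  rw [hT.norm_coord_smul e hxy']
  exact hT.norm_coord_le e hxy'

end IsOrthonormalSet

end Coord

section CoordSystem

variable {k : Type u} [NormedField k] {V : Type v} [NormedAddCommGroup V] [NormedSpace k V]
  {I : Type w}

theorem finite_setOf_le_norm {c : I → k} (hc : Tendsto c cofinite (𝓝 0)) {ε : ℝ} (hε : 0 < ε) :
    {i | ε ≤ ‖c i‖}.Finite := by
  simpa [Filter.eventually_cofinite] using Metric.tendsto_nhds.1 hc ε hε

theorem exists_norm_max {c : I → k} (hc : Tendsto c cofinite (𝓝 0)) {J : Set I}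
    (hJ : ∃ i ∈ J, c i ≠ 0) : ∃ i ∈ J, c i ≠ 0 ∧ ∀ j ∈ J, ‖c j‖ ≤ ‖c i‖ := by
  obtain ⟨i₀, hi₀, h₀⟩ := hJ
  obtain ⟨i, ⟨hiJ, hi⟩, hmax⟩ := Set.exists_max_image (J ∩ {i | ‖c i₀‖ ≤ ‖c i‖})
    (fun i => ‖c i‖) ((finite_setOf_le_norm hc (norm_pos_iff.2 h₀)).inter_of_right J)
    ⟨i₀, hi₀, le_refl ‖c i₀‖⟩
  refine ⟨i, hiJ, norm_pos_iff.1 ((norm_pos_iff.2 h₀).trans_le hi), fun j hj => ?_⟩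
  rcases le_total ‖c i₀‖ ‖c j‖ with hj' | hj'
  · exact hmax j ⟨hj, hj'⟩
  · exact hj'.trans hi

/-- A family of linear forms on `V` which induces an isometric embedding of `B / A` into
`C₀(I, k)` such that the distances to `A` are attained. Nothing is required of the values of the
forms outside `B`. -/
structure IsCoordSystem (φ : I → V →ₗ[k] k) (A B : Submodule k V) : Prop where
  le : A ≤ B
  tendsto : ∀ b ∈ B, Tendsto (fun i => φ i b) cofinite (𝓝 0)
  norm_le : ∀ b ∈ B, ∀ i, ‖φ i b‖ ≤ ‖b‖
  map_eq_zero : ∀ a ∈ A, ∀ i, φ i a = 0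
  exists_norm_sub_le : ∀ b ∈ B, ∃ a ∈ A, ∀ r, 0 ≤ r → (∀ i, ‖φ i b‖ ≤ r) → ‖b - a‖ ≤ r

/-- `B` is subfree relative to `A`: it embeds isometrically into a space `C₀(I, k)` modulo `A`. -/
def IsRelSubfree (A B : Submodule k V) : Prop :=
  ∃ (I : Type v) (φ : I → V →ₗ[k] k), IsCoordSystem φ A B

variable {φ : I → V →ₗ[k] k} {A B C : Submodule k V}

namespace IsCoordSystem

theorem restrict (h : IsCoordSystem φ A B) (hAC : A ≤ C) (hCB : C ≤ B) : IsCoordSystem φ A C where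
  le := hAC
  tendsto b hb := h.tendsto b (hCB hb)
  norm_le b hb := h.norm_le b (hCB hb)
  map_eq_zero := h.map_eq_zero
  exists_norm_sub_le b hb := h.exists_norm_sub_le b (hCB hb)

theorem mem_of_forall_eq_zero (h : IsCoordSystem φ A B) {b : V} (hb : b ∈ B)
    (h₀ : ∀ i, φ i b = 0) : b ∈ A := by
  obtain ⟨a, ha, hba⟩ := h.exists_norm_sub_le b hb
  have hba₀ : ‖b - a‖ ≤ 0 := hba 0 le_rfl fun i => by rw [h₀ i, norm_zero]
  rwa [sub_eq_zero.1 (norm_le_zero_iff.1 hba₀)]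

theorem topologicalClosure (h : IsCoordSystem φ A B) (hB : IsClosed (B : Set V)) :
    IsCoordSystem φ A.topologicalClosure B where
  le := A.topologicalClosure_minimal h.le hB
  tendsto := h.tendsto
  norm_le := h.norm_le
  map_eq_zero a ha i :=
    (A.topologicalClosure_minimal (t := B ⊓ LinearMap.ker (φ i))
      (fun x hx => ⟨h.le hx, h.map_eq_zero x hx i⟩)
      (isClosed_inf_ker hB fun x hx => h.norm_le x hx i) ha).2
  exists_norm_sub_le b hb := by
    obtain ⟨a, ha, hba⟩ := h.exists_norm_sub_le b hb
    exact ⟨a, A.le_topologicalClosure ha, hba⟩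

end IsCoordSystem

theorem IsRelSubfree.restrict (h : IsRelSubfree A B) (hAC : A ≤ C) (hCB : C ≤ B) :
    IsRelSubfree A C :=
  h.imp fun _ ⟨φ, hφ⟩ => ⟨φ, hφ.restrict hAC hCB⟩

variable [IsUltrametricDist V] [CompleteSpace V] [CompleteSpace k]

theorem IsOrthonormalSet.isRelSubfree_of_subset {T T₁ : Set V} (hT : IsOrthonormalSet k T)
    (h : T₁ ⊆ T) : IsRelSubfree (closedSpan (k := k) T₁) (closedSpan (k := k) T) := by
  refine ⟨↥T₁ᶜ, fun e => hT.coord e, closedSpan_mono h,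
    fun b hb => (hT.tendsto_coord hb).comp Subtype.val_injective.tendsto_cofinite,
    fun b hb e => hT.norm_coord_le e hb,
    fun a ha e => hT.coord_eq_zero_of_subset h e.2 ha, fun b hb => ?_⟩
  set f : V → V := fun e => hT.coord e b • e
  have hsum : HasSum f b := hT.hasSum_coord_smul hb
  obtain ⟨a, hsum₁⟩ := hsum.summable.subtype T₁
  have hsum₂ : HasSum (f ∘ ((↑) : ↥T₁ᶜ → V)) (b - a) :=
    hsum₁.hasSum_compl_iff.2 (by rwa [add_sub_cancel])
  refine ⟨a, (isClosed_closedSpan (k := k) T₁).mem_of_tendsto hsum₁ (Eventually.of_forall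
    fun F => Submodule.sum_mem _ fun e _ => Submodule.smul_mem _ _ (subset_closedSpan T₁ e.2)),
    fun r hr hle => norm_le_of_hasSum hsum₂ hr fun e => ?_⟩
  exact (hT.norm_coord_smul e hb).trans_le (hle e)

end CoordSystem

section Elimination

variable {k : Type u} [NormedField k] {V : Type v} [NormedAddCommGroup V] [NormedSpace k V]
  {I : Type w} {φ : I → V →ₗ[k] k} {A B : Submodule k V}

namespace IsCoordSystem

/-- Dividing `z`, made as small as possible modulo `A`, by its largest coordinate gives the
vector `t`. -/
theorem exists_pivot (h : IsCoordSystem φ A B) {z : V} (hz : z ∈ B) (hzA : z ∉ A) :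
    ∃ t ∈ B, ∃ i, ‖t‖ = 1 ∧ φ i t = 1 ∧ z ∈ A ⊔ Submodule.span k {t} := by
  have hne : ∃ i ∈ Set.univ, φ i z ≠ 0 := by
    contrapose! hzA
    exact h.mem_of_forall_eq_zero hz fun i => hzA i (Set.mem_univ i)
  obtain ⟨i, -, hi, hmax⟩ := exists_norm_max (h.tendsto z hz) hne
  obtain ⟨a, ha, hza⟩ := h.exists_norm_sub_le z hz
  set t := (φ i z)⁻¹ • (z - a)
  have htB : t ∈ B := B.smul_mem _ (B.sub_mem hz (h.le ha))
  have hti : φ i t = 1 := by simp [t, h.map_eq_zero a ha, hi]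
  have htz : z = a + φ i z • t := by rw [smul_inv_smul₀ hi, add_sub_cancel]
  refine ⟨t, htB, i, le_antisymm ?_ ?_, hti, ?_⟩
  · rw [norm_smul, norm_inv, inv_mul_le_one₀ (norm_pos_iff.2 hi)]
    exact hza _ (norm_nonneg _) fun j => hmax j (Set.mem_univ j)
  · simpa [hti] using h.norm_le t htB i
  · rw [htz]
    exact Submodule.add_mem_sup ha (Submodule.smul_mem _ _ (Submodule.mem_span_singleton_self t))

variable [IsUltrametricDist k]

theorem eliminate (h : IsCoordSystem φ A B) {t : V} (ht : t ∈ B) (htn : ‖t‖ ≤ 1) {i : I}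
    (hti : φ i t = 1) :
    IsCoordSystem (fun j => φ j - φ j t • φ i) (A ⊔ Submodule.span k {t}) B := by
  have happly : ∀ b j, (φ j - φ j t • φ i) b = φ j (b - φ i b • t) := fun b j => by
    simp [mul_comm]
  have hsub : ∀ b ∈ B, b - φ i b • t ∈ B := fun b hb => B.sub_mem hb (B.smul_mem _ ht)
  refine ⟨sup_le h.le ((Submodule.span_singleton_le_iff_mem _ _).2 ht), fun b hb => ?_,
    fun b hb j => ?_, fun x hx j => ?_, fun b hb => ?_⟩
  · simpa only [happly] using h.tendsto _ (hsub b hb)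
  · have hjt : ‖φ j t‖ ≤ 1 := (h.norm_le t ht j).trans htn
    rw [LinearMap.sub_apply, LinearMap.smul_apply, smul_eq_mul]
    refine norm_sub_le_of_le (h.norm_le b hb j) ?_
    rw [norm_mul]
    exact (mul_le_of_le_one_left (norm_nonneg _) hjt).trans (h.norm_le b hb i)
  · obtain ⟨a, ha, y, hy, rfl⟩ := Submodule.mem_sup.1 hx
    obtain ⟨c, rfl⟩ := Submodule.mem_span_singleton.1 hy
    simp [h.map_eq_zero a ha, hti, mul_comm]
  · obtain ⟨a, ha, hle⟩ := h.exists_norm_sub_le _ (hsub b hb)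
    refine ⟨a + φ i b • t, Submodule.add_mem_sup ha (Submodule.smul_mem _ _
      (Submodule.mem_span_singleton_self t)), fun r hr hbr => ?_⟩
    rw [add_comm, ← sub_sub]
    exact hle r hr fun j => by simpa only [happly] using hbr j

variable [IsUltrametricDist V] {T : Set V}

theorem exists_insert (h : IsCoordSystem φ (closedSpan T) B) (hB : IsClosed (B : Set V))
    (hT : IsOrthonormalSet k T) {z : V} (hz : z ∈ B) :
    ∃ (T' : Set V) (φ' : I → V →ₗ[k] k), T ⊆ T' ∧ IsOrthonormalSet k T' ∧
      IsCoordSystem φ' (closedSpan T') B ∧ z ∈ closedSpan (k := k) T' := by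
  by_cases hzT : z ∈ closedSpan (k := k) T
  · exact ⟨T, φ, subset_rfl, hT, h, hzT⟩
  obtain ⟨t, ht, i, htn, hti, hzt⟩ := h.exists_pivot hz hzT
  have hT' : IsOrthonormalSet k (insert t T) := hT.insert htn fun y hy c => by
    have hyT := span_le_closedSpan T hy
    simpa [h.map_eq_zero y hyT i, hti] using
      h.norm_le (y + c • t) (B.add_mem (h.le hyT) (B.smul_mem c ht)) i
  have hle : closedSpan T ⊔ Submodule.span k {t} ≤ closedSpan (insert t T) :=
    sup_le (closedSpan_mono (Set.subset_insert t T))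
      ((Submodule.span_mono (by simp)).trans (span_le_closedSpan _))
  have heq :
      (closedSpan T ⊔ Submodule.span k {t}).topologicalClosure = closedSpan (insert t T) := by
    refine le_antisymm (Submodule.topologicalClosure_minimal _ hle (isClosed_closedSpan _))
      (Submodule.topologicalClosure_mono ?_)
    rw [Submodule.span_insert, sup_comm]
    exact sup_le_sup_right (span_le_closedSpan T) _
  exact ⟨insert t T, _, Set.subset_insert t T, hT',
    heq ▸ (h.eliminate ht htn.le hti).topologicalClosure hB, hle hzt⟩

theorem exists_extend_sequence (h : IsCoordSystem φ (closedSpan T) B) (hB : IsClosed (B : Set V))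
    (hT : IsOrthonormalSet k T) {z : ℕ → V} (hz : ∀ n, z n ∈ B) :
    ∃ T', T ⊆ T' ∧ IsOrthonormalSet k T' ∧ T' ⊆ B ∧ ∀ n, z n ∈ closedSpan (k := k) T' := by
  let P : Set V → Prop := fun S =>
    IsOrthonormalSet k S ∧ ∃ φ' : I → V →ₗ[k] k, IsCoordSystem φ' (closedSpan S) B
  have hstep : ∀ (n : ℕ) (S : {S // P S}), ∃ S' : {S // P S},
      S.1 ⊆ S'.1 ∧ z n ∈ closedSpan (k := k) S'.1 := by
    rintro n ⟨S, hS, φ', hφ'⟩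
    obtain ⟨S', φ'', hSS', hS', hφ'', hzS'⟩ := hφ'.exists_insert hB hS (hz n)
    exact ⟨⟨S', hS', φ'', hφ''⟩, hSS', hzS'⟩
  choose f hf hfz using hstep
  let S : ℕ → {S // P S} := fun n => Nat.rec ⟨T, hT, φ, h⟩ f n
  have hmono : Monotone fun n => (S n).1 := monotone_nat_of_le_succ fun n => hf n (S n)
  have hsub := Set.subset_iUnion fun n => (S n).1
  refine ⟨⋃ n, (S n).1, hsub 0, .iUnion hmono.directed_le fun n => (S n).2.1,
    Set.iUnion_subset fun n => ?_, fun n => closedSpan_mono (hsub (n + 1)) (hfz n (S n))⟩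
  obtain ⟨φ', hφ'⟩ := (S n).2.2
  exact (subset_closedSpan _).trans hφ'.le

end IsCoordSystem

end Elimination

section CountableApproximation

variable {k : Type u} [NormedField k] {V : Type v} [NormedAddCommGroup V] [NormedSpace k V]
  {I : Type w}

theorem exists_countable_norm_cofinal (f : V →ₗ[k] k) (W : Set V) :
    ∃ D ⊆ W, D.Countable ∧ ∀ w ∈ W, ∃ d ∈ D, ‖f w‖ ≤ ‖f d‖ := by
  by_cases hmax : ∃ d ∈ W, ∀ w ∈ W, ‖f w‖ ≤ ‖f d‖
  · obtain ⟨d, hd, h⟩ := hmax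
    exact ⟨{d}, Set.singleton_subset_iff.2 hd, Set.countable_singleton d,
      fun w hw => ⟨d, rfl, h w hw⟩⟩
  push Not at hmax
  let Q : Set ℚ := {q | ∃ w ∈ W, (q : ℝ) < ‖f w‖}
  choose g hgW hg using fun q : Q => q.2
  refine ⟨Set.range g, Set.range_subset_iff.2 hgW, Set.countable_range g, fun w hw => ?_⟩
  obtain ⟨w', hw', hlt⟩ := hmax w hw
  obtain ⟨q, hq, hq'⟩ := exists_rat_btwn hlt
  exact ⟨g ⟨q, w', hw', hq'⟩, Set.mem_range_self _, (hq.trans (hg ⟨q, w', hw', hq'⟩)).le⟩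

/-- Elimination of one coordinate at a time: a countable subset of `W` on which `‖φ j ·‖` is
cofinal suffices to kill `φ j`. -/
theorem exists_countable_generators (φ : I → V →ₗ[k] k) (F : Finset I) (W : AddSubgroup V)
    (hW : ∀ c : k, ‖c‖ ≤ 1 → ∀ x ∈ W, c • x ∈ W) :
    ∃ Z ⊆ (W : Set V), Z.Countable ∧
      ∀ x ∈ W, ∃ z ∈ W, z ∈ Submodule.span k Z ∧ ∀ i ∈ F, φ i (x - z) = 0 := by
  classical
  induction F using Finset.induction_on generalizing W with
  | empty =>
    exact ⟨∅, Set.empty_subset _, Set.countable_empty,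
      fun x _ => ⟨0, W.zero_mem, Submodule.zero_mem _, by simp⟩⟩
  | insert j F _ ih =>
    let W₀ : AddSubgroup V := W ⊓ (LinearMap.ker (φ j)).toAddSubgroup
    have hW₀ : ∀ {x}, x ∈ W₀ ↔ x ∈ W ∧ φ j x = 0 := Iff.rfl
    obtain ⟨Z, hZW, hZ, hZF⟩ := ih W₀ fun c hc x hx =>
      hW₀.2 ⟨hW c hc x hx.1, by rw [map_smul, (hW₀.1 hx).2, smul_zero]⟩
    obtain ⟨D, hDW, hD, hDmax⟩ := exists_countable_norm_cofinal (φ j) (W : Set V)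
    refine ⟨Z ∪ D, Set.union_subset (fun z hz => (hZW hz).1) hDW, hZ.union hD, fun x hx => ?_⟩
    obtain ⟨d, hd, hle⟩ := hDmax x hx
    set c := φ j x / φ j d
    have hcW : c • d ∈ W := hW c
      (by rw [norm_div]; exact div_le_one_of_le₀ hle (norm_nonneg _)) d (hDW hd)
    have hcd : φ j (c • d) = φ j x := by
      rw [map_smul, smul_eq_mul]
      exact div_mul_cancel_of_imp fun h₀ => by simpa [h₀] using hle
    obtain ⟨z, hzW, hz, hzF⟩ := hZF (x - c • d)
      (hW₀.2 ⟨W.sub_mem hx hcW, by rw [map_sub, hcd, sub_self]⟩)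
    refine ⟨z + c • d, W.add_mem hzW.1 hcW, Submodule.add_mem _
      (Submodule.span_mono Set.subset_union_left hz)
      (Submodule.smul_mem _ _ (Submodule.subset_span (Or.inr hd))), fun i hi => ?_⟩
    rw [add_comm, ← sub_sub]
    rcases Finset.mem_insert.1 hi with rfl | hi
    · rw [map_sub, map_sub, hcd, (hW₀.1 hzW).2, sub_self, sub_zero]
    · exact hzF i hi

variable [IsUltrametricDist k] {A B : Submodule k V}

/-- The vectors of `B` whose coordinates in `J` are integral. -/
def integralOn (φ : I → V →ₗ[k] k) (B : Submodule k V) (J : Set I) : AddSubgroup V where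
  carrier := {x | x ∈ B ∧ ∀ i ∈ J, ‖φ i x‖ ≤ 1}
  zero_mem' := ⟨B.zero_mem, fun i _ => by simp⟩
  add_mem' hx hy := ⟨B.add_mem hx.1 hy.1, fun i hi => by
    rw [map_add]; exact norm_add_le_of_le (hx.2 i hi) (hy.2 i hi)⟩
  neg_mem' hx := ⟨B.neg_mem hx.1, fun i hi => by
    rw [map_neg, norm_neg]; exact hx.2 i hi⟩

theorem exists_countable_approximation (φ : I → V →ₗ[k] k) (B : Submodule k V) (J : Set I)
    (F : Finset I) :
    ∃ Z ⊆ (B : Set V), Z.Countable ∧ ∀ x ∈ B, ∀ c : k, c ≠ 0 →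
      (∀ i ∈ J, i ∉ F → ‖φ i x‖ ≤ ‖c‖) →
        ∃ z ∈ Submodule.span k Z, ∀ i ∈ J, ‖φ i (x - z)‖ ≤ ‖c‖ := by
  obtain ⟨Z, hZW, hZ, hZF⟩ := exists_countable_generators φ F (integralOn φ B (J \ F)) (by
    rintro c hc x ⟨hx, hx'⟩
    refine ⟨B.smul_mem c hx, fun i hi => ?_⟩
    rw [map_smul, norm_smul]
    exact mul_le_one₀ hc (norm_nonneg _) (hx' i hi))
  refine ⟨Z, fun z hz => (hZW hz).1, hZ, fun x hx c hc hxc => ?_⟩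
  have hscale : ∀ {y i}, ‖φ i y‖ ≤ ‖c‖ ↔ ‖φ i (c⁻¹ • y)‖ ≤ 1 := fun {y i} => by
    rw [map_smul, norm_smul, norm_inv, inv_mul_le_one₀ (norm_pos_iff.2 hc)]
  have hxJ : ∀ i ∈ J, i ∉ F → ‖φ i (c⁻¹ • x)‖ ≤ 1 := fun i hi hiF => hscale.1 (hxc i hi hiF)
  obtain ⟨z, hzW, hz, hzF⟩ := hZF (c⁻¹ • x) ⟨B.smul_mem _ hx, fun i hi => hxJ i hi.1 hi.2⟩
  refine ⟨c • z, Submodule.smul_mem _ _ hz, fun i hi => hscale.2 ?_⟩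
  rw [smul_sub, inv_smul_smul₀ hc]
  by_cases hiF : i ∈ F
  · rw [hzF i hiF, norm_zero]
    exact zero_le_one
  · rw [map_sub]
    exact norm_sub_le_of_le (hxJ i hi hiF) (hzW.2 i ⟨hi, hiF⟩)

end CountableApproximation

section Countable

variable {k : Type u} [NontriviallyNormedField k] [IsUltrametricDist k] {V : Type v}
  [NormedAddCommGroup V] [NormedSpace k V] {I : Type w} [Countable I] {φ : I → V →ₗ[k] k}
  {A B : Submodule k V}

theorem IsCoordSystem.exists_countable_generating (h : IsCoordSystem φ A B) :
    ∃ Z ⊆ (B : Set V), Z.Countable ∧ B ≤ closedSpan (k := k) ((A : Set V) ∪ Z) := by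
  choose Z hZB hZ hap using exists_countable_approximation φ B Set.univ
  refine ⟨⋃ F, Z F, Set.iUnion_subset hZB, Set.countable_iUnion hZ,
    fun b hb => mem_closedSpan_iff.2 fun ε hε => ?_⟩
  obtain ⟨c, hc, hcε⟩ := NormedField.exists_norm_lt k hε
  have hfin := finite_setOf_le_norm (h.tendsto b hb) hc
  obtain ⟨z, hz, hbz⟩ := hap hfin.toFinset b hb c (norm_pos_iff.1 hc) fun i _ hi =>
    (not_le.1 fun hle => hi (hfin.mem_toFinset.2 hle)).le
  have hzB : z ∈ B := Submodule.span_le.2 (hZB _) hz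
  obtain ⟨a, ha, hba⟩ := h.exists_norm_sub_le (b - z) (B.sub_mem hb hzB)
  refine ⟨z + a, Submodule.add_mem _ ?_ (Submodule.subset_span (Or.inl ha)), ?_⟩
  · exact Submodule.span_mono ((Set.subset_iUnion Z _).trans Set.subset_union_right) hz
  · rw [← sub_sub]
    exact (hba ‖c‖ hc.le fun i => hbz i (Set.mem_univ i)).trans_lt hcε

theorem IsCoordSystem.exists_extend_of_countable [IsUltrametricDist V] {T : Set V}
    (h : IsCoordSystem φ (closedSpan T) B) (hB : IsClosed (B : Set V))
    (hT : IsOrthonormalSet k T) :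
    ∃ T', T ⊆ T' ∧ IsOrthonormalSet k T' ∧ closedSpan T' = B := by
  obtain ⟨Z, hZB, hZ, hBZ⟩ := h.exists_countable_generating
  obtain ⟨z, hz⟩ := (hZ.insert 0).exists_eq_range (Set.insert_nonempty 0 Z)
  have hzB : ∀ n, z n ∈ B := fun n =>
    Set.insert_subset B.zero_mem hZB (hz ▸ Set.mem_range_self n)
  obtain ⟨T', hTT', hT', hT'B, hzT'⟩ := h.exists_extend_sequence hB hT hzB
  have hZT' : Z ⊆ closedSpan (k := k) T' :=
    (Set.subset_insert 0 Z).trans (hz ▸ Set.range_subset_iff.2 hzT')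
  exact ⟨T', hTT', hT', le_antisymm (closedSpan_le hB hT'B)
    (hBZ.trans (closedSpan_le_closedSpan (Set.union_subset (closedSpan_mono hTT') hZT')))⟩

end Countable

section Gruson

variable {k : Type u} [NormedField k] {V : Type v} [NormedAddCommGroup V] [NormedSpace k V]
  {I : Type w} {φ : I → V →ₗ[k] k} {A B : Submodule k V} {J J' : Set I}

/-- The vectors of `B` whose coordinates vanish outside `J`. -/
def supportedOn (φ : I → V →ₗ[k] k) (B : Submodule k V) (J : Set I) : Submodule k V :=
  B ⊓ ⨅ i ∈ Jᶜ, LinearMap.ker (φ i)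

theorem mem_supportedOn {x : V} : x ∈ supportedOn φ B J ↔ x ∈ B ∧ ∀ i ∉ J, φ i x = 0 := by
  simp [supportedOn]

theorem supportedOn_le : supportedOn φ B J ≤ B := inf_le_left

theorem supportedOn_mono (h : J ⊆ J') : supportedOn φ B J ≤ supportedOn φ B J' := fun _ hx =>
  have ⟨hxB, hxJ⟩ := mem_supportedOn.1 hx
  mem_supportedOn.2 ⟨hxB, fun i hi => hxJ i fun hi' => hi (h hi')⟩

theorem IsCoordSystem.supportedOn_empty (h : IsCoordSystem φ A B) : supportedOn φ B ∅ = A := by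
  refine le_antisymm (fun x hx => ?_) fun a ha =>
    mem_supportedOn.2 ⟨h.le ha, fun i _ => h.map_eq_zero a ha i⟩
  have ⟨hxB, hx₀⟩ := mem_supportedOn.1 hx
  exact h.mem_of_forall_eq_zero hxB fun i => hx₀ i (Set.notMem_empty i)

theorem IsCoordSystem.isClosed_supportedOn (h : IsCoordSystem φ A B)
    (hB : IsClosed (B : Set V)) : IsClosed (supportedOn φ B J : Set V) := by
  have heq : (supportedOn φ B J : Set V) =
      (B : Set V) ∩ ⋂ i ∈ Jᶜ, ((B ⊓ LinearMap.ker (φ i) : Submodule k V) : Set V) := by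
    ext x
    simp +contextual [mem_supportedOn]
  rw [heq]
  exact hB.inter (isClosed_biInter fun i _ => isClosed_inf_ker hB fun x hx => h.norm_le x hx i)

/-- `J` is adapted to the coordinates `φ` of `B`: the coordinates outside `J` embed `B`
isometrically modulo the vectors supported on `J`, with distances attained. -/
def IsAdaptedSet (φ : I → V →ₗ[k] k) (B : Submodule k V) (J : Set I) : Prop :=
  ∀ b ∈ B, ∃ a ∈ supportedOn φ B J, ∀ r, 0 ≤ r → (∀ i ∉ J, ‖φ i b‖ ≤ r) → ‖b - a‖ ≤ r

namespace IsAdaptedSet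

theorem isCoordSystem (hJ : IsAdaptedSet φ B J) (h : IsCoordSystem φ A B) (hJJ' : J ⊆ J') :
    IsCoordSystem (fun i : (J' \ J : Set I) => φ i) (supportedOn φ B J) (supportedOn φ B J') where
  le := supportedOn_mono hJJ'
  tendsto b hb := (h.tendsto b (supportedOn_le hb)).comp Subtype.val_injective.tendsto_cofinite
  norm_le b hb i := h.norm_le b (supportedOn_le hb) i
  map_eq_zero a ha i := (mem_supportedOn.1 ha).2 i i.2.2
  exists_norm_sub_le b hb := by
    obtain ⟨a, ha, hba⟩ := hJ b (supportedOn_le hb)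
    refine ⟨a, ha, fun r hr hle => hba r hr fun i hi => ?_⟩
    by_cases hi' : i ∈ J'
    · exact hle ⟨i, hi', hi⟩
    · rwa [(mem_supportedOn.1 hb).2 i hi', norm_zero]

theorem empty (h : IsCoordSystem φ A B) : IsAdaptedSet φ B ∅ := fun b hb => by
  obtain ⟨a, ha, hba⟩ := h.exists_norm_sub_le b hb
  exact ⟨a, h.supportedOn_empty.symm ▸ ha,
    fun r hr hle => hba r hr fun i => hle i (Set.notMem_empty i)⟩

theorem of_forall_max (h : IsCoordSystem φ A B)
    (hJ : ∀ b ∈ B, ∀ i ∉ J, φ i b ≠ 0 → (∀ j ∉ J, ‖φ j b‖ ≤ ‖φ i b‖) →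
      ∃ a ∈ supportedOn φ B J, ‖b - a‖ ≤ ‖φ i b‖) : IsAdaptedSet φ B J := fun b hb => by
  by_cases h₀ : ∀ i ∉ J, φ i b = 0
  · exact ⟨b, mem_supportedOn.2 ⟨hb, h₀⟩, fun r hr _ => by rwa [sub_self, norm_zero]⟩
  push Not at h₀
  obtain ⟨i, hi, hi₀, hmax⟩ := exists_norm_max (h.tendsto b hb) (J := Jᶜ) h₀
  obtain ⟨a, ha, hba⟩ := hJ b hb i hi hi₀ hmax
  exact ⟨a, ha, fun r _ hr => hba.trans (hr i hi)⟩

theorem iUnion {ι : Type*} [Nonempty ι] {J : ι → Set I} (h : IsCoordSystem φ A B)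
    (hdir : Directed (· ⊆ ·) J) (hJ : ∀ i, IsAdaptedSet φ B (J i)) :
    IsAdaptedSet φ B (⋃ i, J i) := by
  refine of_forall_max h fun b hb i _ hi₀ hmax => ?_
  have hfin := (finite_setOf_le_norm (h.tendsto b hb) (norm_pos_iff.2 hi₀)).inter_of_right
    (⋃ i, J i)
  obtain ⟨s, hs⟩ := hdir.exists_mem_subset_of_finset_subset_biUnion (s := hfin.toFinset)
    (by simp)
  obtain ⟨a, ha, hba⟩ := hJ s b hb
  refine ⟨a, supportedOn_mono (Set.subset_iUnion J s) ha, hba _ (norm_nonneg _) fun j hj => ?_⟩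
  by_cases hjJ : j ∈ ⋃ i, J i
  · exact (not_le.1 fun hle => hj (hs (hfin.mem_toFinset.2 ⟨hjJ, hle⟩))).le
  · exact hmax j hjJ

end IsAdaptedSet

theorem exists_countable_superset_closed {g : Finset I → Set I} (hg : ∀ F, (g F).Countable)
    (i : I) : ∃ K : Set I, i ∈ K ∧ K.Countable ∧ ∀ F : Finset I, (F : Set I) ⊆ K → g F ⊆ K := by
  let step : Set I → Set I := fun K => K ∪ ⋃ F ∈ {F : Finset I | (F : Set I) ⊆ K}, g F
  have hstep : ∀ K, K.Countable → (step K).Countable := fun K hK => by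
    have hF : {F : Finset I | (F : Set I) ⊆ K}.Countable :=
      ((Set.countable_ofPred_finite_subset hK).preimage Finset.coe_injective).mono
        fun F hF => And.intro F.finite_toSet hF
    exact hK.union (hF.biUnion fun F _ => hg F)
  let K : ℕ → Set I := fun n => step^[n] {i}
  have hsucc : ∀ n, K (n + 1) = step (K n) := fun n => Function.iterate_succ_apply' step n {i}
  have hcount : ∀ n, (K n).Countable := fun n => by
    induction n with
    | zero => exact Set.countable_singleton i
    | succ n ih => exact hsucc n ▸ hstep _ ih
  have hmono : Monotone K := monotone_nat_of_le_succ fun n => hsucc n ▸ Set.subset_union_left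
  refine ⟨⋃ n, K n, Set.mem_iUnion.2 ⟨0, rfl⟩, Set.countable_iUnion hcount, fun F hF => ?_⟩
  obtain ⟨n, hn⟩ := hmono.directed_le.exists_mem_subset_of_finset_subset_biUnion hF
  have hgF : g F ⊆ step (K n) := (Set.subset_biUnion_of_mem (u := g) hn).trans
    Set.subset_union_right
  exact hgF.trans (hsucc n ▸ Set.subset_iUnion K (n + 1))

theorem IsCoordSystem.countable_support (h : IsCoordSystem φ A B) {b : V} (hb : b ∈ B) :
    {i | φ i b ≠ 0}.Countable := by
  have hcount := (h.tendsto b hb).countable_compl_preimage_ker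
  rwa [ker_nhds] at hcount

/-- `J'` is obtained from `J` by adding a countable set closed under passing from a finite set `F`
to the supports of countably many vectors which approximate the vectors of `B` whose large
coordinates outside `J` lie in `F`. -/
theorem IsAdaptedSet.exists_insert [IsUltrametricDist k] (hJ : IsAdaptedSet φ B J)
    (h : IsCoordSystem φ A B) (i₀ : I) :
    ∃ J' : Set I, J ⊆ J' ∧ i₀ ∈ J' ∧ (J' \ J).Countable ∧ IsAdaptedSet φ B J' := by
  choose Z hZB hZ hap using exists_countable_approximation φ B Jᶜ
  obtain ⟨K, hi₀, hK, hZK⟩ := exists_countable_superset_closed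
    (g := fun F => ⋃ z ∈ Z F, {i | φ i z ≠ 0})
    (fun F => (hZ F).biUnion fun z hz => h.countable_support (hZB F hz)) i₀
  refine ⟨J ∪ K, Set.subset_union_left, Or.inr hi₀, hK.mono (by
    rw [Set.union_sdiff_left]; exact Set.sdiff_subset),
    .of_forall_max h fun b hb i _ hi hmax => ?_⟩
  have hfin := (finite_setOf_le_norm (h.tendsto b hb) (norm_pos_iff.2 hi)).inter_of_right K
  obtain ⟨z, hz, hbz⟩ := hap hfin.toFinset b hb (φ i b) hi fun j hj hjF => by
    by_cases hjK : j ∈ K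
    · exact (not_le.1 fun hle => hjF (hfin.mem_toFinset.2 ⟨hjK, hle⟩)).le
    · exact hmax j (not_or.2 ⟨hj, hjK⟩)
  have hFK : (hfin.toFinset : Set I) ⊆ K := fun j hj => (hfin.mem_toFinset.1 hj).1
  have hzK : z ∈ supportedOn φ B (J ∪ K) := by
    refine Submodule.span_le.2 (fun y hy => mem_supportedOn.2 ⟨hZB _ hy, fun j hj => ?_⟩) hz
    by_contra hne
    exact hj (Or.inr (hZK _ hFK (Set.mem_biUnion hy hne)))
  obtain ⟨a, ha, hle⟩ := hJ (b - z) (B.sub_mem hb (supportedOn_le hzK))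
  refine ⟨z + a, Submodule.add_mem _ hzK (supportedOn_mono Set.subset_union_left ha), ?_⟩
  rw [← sub_sub]
  exact hle _ (norm_nonneg _) hbz

variable {T : Set V}

/-- An orthonormal set which spans the vectors supported on an adapted set of coordinates: the
partial objects in the construction of an orthonormal basis by Zorn's lemma. -/
structure IsAdaptedBasis (φ : I → V →ₗ[k] k) (B : Submodule k V) (J : Set I) (T : Set V) :
    Prop where
  isAdaptedSet : IsAdaptedSet φ B J
  isOrthonormalSet : IsOrthonormalSet k T
  closedSpan_eq : closedSpan T = supportedOn φ B J

theorem IsAdaptedBasis.iUnion [IsUltrametricDist V] {ι : Type*} [Nonempty ι] {J : ι → Set I}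
    {T : ι → Set V} (h : IsCoordSystem φ A B) (hB : IsClosed (B : Set V))
    (hJ : Directed (· ⊆ ·) J) (hT : Directed (· ⊆ ·) T)
    (hJT : ∀ s, IsAdaptedBasis φ B (J s) (T s)) :
    IsAdaptedBasis φ B (⋃ s, J s) (⋃ s, T s) where
  isAdaptedSet := .iUnion h hJ fun s => (hJT s).isAdaptedSet
  isOrthonormalSet := .iUnion hT fun s => (hJT s).isOrthonormalSet
  closedSpan_eq := by
    refine le_antisymm (closedSpan_le (h.isClosed_supportedOn hB) (Set.iUnion_subset fun s => ?_))
      fun b hb => mem_closedSpan_iff.2 fun ε hε => ?_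
    · exact (subset_closedSpan _).trans
        ((hJT s).closedSpan_eq.le.trans (supportedOn_mono (Set.subset_iUnion J s)))
    have ⟨hbB, hbJ⟩ := mem_supportedOn.1 hb
    have hfin := finite_setOf_le_norm (h.tendsto b hbB) (half_pos hε)
    have hsub : (hfin.toFinset : Set I) ⊆ ⋃ s, J s := fun j hj => by
      by_contra hjJ
      have hle : ε / 2 ≤ ‖φ j b‖ := hfin.mem_toFinset.1 hj
      rw [hbJ j hjJ, norm_zero] at hle
      exact hle.not_gt (half_pos hε)
    obtain ⟨s, hs⟩ := hJ.exists_mem_subset_of_finset_subset_biUnion hsub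
    obtain ⟨a, ha, hba⟩ := (hJT s).isAdaptedSet b hbB
    have hba' : ‖b - a‖ ≤ ε / 2 := hba _ (half_pos hε).le fun j hj =>
      (not_le.1 fun hle => hj (hs (hfin.mem_toFinset.2 hle))).le
    obtain ⟨x, hx, hax⟩ := mem_closedSpan_iff.1 ((hJT s).closedSpan_eq.ge ha) (ε / 2) (half_pos hε)
    refine ⟨x, Submodule.span_mono (Set.subset_iUnion T s) hx, ?_⟩
    rw [← sub_add_sub_cancel b a x]
    exact (norm_add_le_of_le hba' hax.le).trans_lt (half_lt_self hε)

end Gruson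

/-- A relative form of Gruson's theorem on closed subspaces of free Banach spaces. -/
theorem IsCoordSystem.exists_extend {k : Type u} [NontriviallyNormedField k] [IsUltrametricDist k]
    {V : Type v} [NormedAddCommGroup V] [NormedSpace k V] [IsUltrametricDist V] {I : Type w}
    {φ : I → V →ₗ[k] k} {B : Submodule k V} {T : Set V} (h : IsCoordSystem φ (closedSpan T) B)
    (hB : IsClosed (B : Set V)) (hT : IsOrthonormalSet k T) :
    ∃ T', T ⊆ T' ∧ IsOrthonormalSet k T' ∧ closedSpan T' = B := by
  have hchain : ∀ c ⊆ {p : Set I × Set V | IsAdaptedBasis φ B p.1 p.2}, IsChain (· ≤ ·) c →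
      ∀ p ∈ c, ∃ ub ∈ {p : Set I × Set V | IsAdaptedBasis φ B p.1 p.2}, ∀ q ∈ c, q ≤ ub := by
    intro c hc hchain p hp
    have : Nonempty c := ⟨⟨p, hp⟩⟩
    have hdir : Directed (· ≤ ·) ((↑) : c → Set I × Set V) :=
      directedOn_iff_directed.1 hchain.directedOn
    refine ⟨(⋃ q : c, q.1.1, ⋃ q : c, q.1.2), IsAdaptedBasis.iUnion h hB
      (hdir.mono_comp _ fun _ _ hle => hle.1) (hdir.mono_comp _ fun _ _ hle => hle.2)
      fun q => hc q.2, fun q hq => ⟨?_, ?_⟩⟩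
    · exact Set.subset_iUnion (fun q : c => q.1.1) ⟨q, hq⟩
    · exact Set.subset_iUnion (fun q : c => q.1.2) ⟨q, hq⟩
  obtain ⟨⟨J, T'⟩, hle, hmax⟩ := zorn_le_nonempty₀ _ hchain (∅, T)
    ⟨.empty h, hT, h.supportedOn_empty.symm⟩
  obtain ⟨hJ, hT', hT'J⟩ := hmax.prop
  have huniv : J = Set.univ := Set.eq_univ_of_forall fun i => by
    obtain ⟨J', hJJ', hi, hcount, hJ'⟩ := hJ.exists_insert h i
    have : Countable (J' \ J : Set I) := hcount.to_subtype
    have hφ := hJ.isCoordSystem h hJJ'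
    rw [← hT'J] at hφ
    obtain ⟨T'', hT'T'', hT'', hT''J'⟩ := hφ.exists_extend_of_countable
      (h.isClosed_supportedOn hB) hT'
    exact (hmax.le_of_ge (y := (J', T'')) ⟨hJ', hT'', hT''J'⟩ ⟨hJJ', hT'T''⟩).1 hi
  exact ⟨T', hle.2, hT', hT'J.trans (by simp [huniv, supportedOn])⟩

section Free

variable {k : Type u} [NormedField k] {V : Type v} [NormedAddCommGroup V] [NormedSpace k V]

theorem closedSpan_empty : closedSpan (k := k) (∅ : Set V) = ⊥ :=
  eq_bot_iff.2 (closedSpan_le (by simp) (Set.empty_subset _))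

theorem exists_closedSpan_eq_top_mk_eq_rank :
    ∃ G : Set V, closedSpan (k := k) G = ⊤ ∧ #G = rank k V :=
  csInf_mem (s := {c | ∃ S : Set V, closedSpan (k := k) S = ⊤ ∧ #S = c})
    ⟨_, Set.univ, eq_top_iff.2 (subset_closedSpan _), rfl⟩

section Isometry

variable {W : Type w} [NormedAddCommGroup W] [NormedSpace k W]

theorem isOrthonormalSet_image_iff (f : W →ₗᵢ[k] V) {T : Set W} :
    IsOrthonormalSet k (f '' T) ↔ IsOrthonormalSet k T := by
  have hnorm (l : W →₀ k) : ‖Finsupp.linearCombination k id (l.mapDomain f)‖ =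
      ‖Finsupp.linearCombination k id l‖ := by
    rw [Finsupp.linearCombination_mapDomain, ← f.norm_map, ← f.coe_toLinearMap,
      Finsupp.apply_linearCombination]
    rfl
  refine ⟨fun h => ⟨fun e he => ?_, fun l hl e => ?_⟩, fun h => ⟨?_, fun l hl e => ?_⟩⟩
  · rw [← f.norm_map, h.norm_eq_one _ ⟨e, he, rfl⟩]
  · have hl' : l.mapDomain f ∈ Finsupp.supported k k (f '' T) := by
      classical
      refine (Finset.coe_subset.2 Finsupp.mapDomain_support).trans ?_
      rw [Finset.coe_image]
      exact Set.image_mono hl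
    rw [← Finsupp.mapDomain_apply f.injective, ← hnorm]
    exact h.norm_apply_le _ hl' _
  · rintro _ ⟨e, he, rfl⟩
    rw [f.norm_map, h.norm_eq_one e he]
  · by_cases he : e ∈ Set.range f
    · obtain ⟨e, rfl⟩ := he
      have hl' : l.comapDomain f f.injective.injOn ∈ Finsupp.supported k k T := fun x hx => by
        have hx' : f x ∈ l.support := by simpa using hx
        exact (f.injective.mem_set_image).1 (hl hx')
      have hmap := Finsupp.mapDomain_comapDomain f f.injective l
        (hl.trans (Set.image_subset_range f T))
      rw [← hmap, hnorm, Finsupp.mapDomain_apply f.injective]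
      exact h.norm_apply_le _ hl' e
    · have hle : l e = 0 := (Finsupp.mem_supported' k l).1 hl e
        fun he' => he (Set.image_subset_range f T he')
      rw [hle, norm_zero]
      exact norm_nonneg _

theorem map_mem_closedSpan_image_iff (f : W →ₗᵢ[k] V) {T : Set W} {x : W} :
    f x ∈ closedSpan (k := k) (f '' T) ↔ x ∈ closedSpan (k := k) T := by
  have hspan : Submodule.span k (f '' T) = (Submodule.span k T).map f.toLinearMap :=
    (Submodule.map_span f.toLinearMap T).symm
  simp only [mem_closedSpan_iff, hspan, Submodule.mem_map, exists_exists_and_eq_and,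
    LinearIsometry.coe_toLinearMap, ← map_sub, f.norm_map]

end Isometry

namespace IsOrthonormalSchauderBasis

variable {E : Set V}

theorem isOrthonormalSet (hE : IsOrthonormalSchauderBasis k E) : IsOrthonormalSet k E where
  norm_eq_one := hE.norm_eq_one
  norm_apply_le l hl e := by
    by_cases he : e ∈ E
    · have hsum : HasSum (fun x : E => l x • (x : V)) (Finsupp.linearCombination k id l) := by
        refine (hasSum_subtype_iff_of_support_subset (f := fun x : V => l x • x) ?_).2
          (hasSum_sum_of_ne_finset_zero fun x hx => ?_)
        · exact fun x hx => hl (Finsupp.mem_support_iff.2 (left_ne_zero_of_smul hx))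
        · rw [Finsupp.notMem_support_iff.1 hx, zero_smul]
      have htendsto : Tendsto (fun x : E => l x) cofinite (𝓝 0) :=
        tendsto_nhds_of_eventually_eq <| (l.hasFiniteSupport.preimage
          Subtype.val_injective.injOn).subset fun x hx => hx
      obtain ⟨s, hs, hnorm⟩ := hE.norm_sum _ htendsto
      rw [← hs.unique hsum, hnorm]
      exact le_ciSup htendsto.norm.bddAbove_range_of_cofinite ⟨e, he⟩
    · rw [(Finsupp.mem_supported' k l).1 hl e he, norm_zero]
      exact norm_nonneg _

theorem closedSpan_eq_top (hE : IsOrthonormalSchauderBasis k E) :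
    closedSpan (k := k) E = ⊤ := by
  refine eq_top_iff.2 fun x _ => ?_
  obtain ⟨c, -, hc⟩ := hE.exists_sum x
  exact (isClosed_closedSpan (k := k) E).mem_of_tendsto hc (Eventually.of_forall fun F =>
    Submodule.sum_mem _ fun e _ => Submodule.smul_mem _ _ (subset_closedSpan E e.2))

end IsOrthonormalSchauderBasis

variable [IsUltrametricDist V]

theorem IsOrthonormalSet.norm_apply_le_of_hasSum {T : Set V} (hT : IsOrthonormalSet k T)
    {c : T → k} {s : V} (hs : HasSum (fun e : T => c e • (e : V)) s) (e : T) : ‖c e‖ ≤ ‖s‖ := by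
  classical
  refine ge_of_tendsto hs.norm ((eventually_ge_atTop {e}).mono fun F hF => ?_)
  have hrest : ∑ x ∈ F.erase e, c x • (x : V) ∈ Submodule.span k (T \ {(e : V)}) :=
    Submodule.sum_mem _ fun x hx => Submodule.smul_mem _ _ (Submodule.subset_span
      ⟨x.2, fun hxe => Finset.ne_of_mem_erase hx (Subtype.ext hxe)⟩)
  have hle := hT.norm_le_norm_add_of_disjoint Set.sdiff_subset
    (Set.singleton_subset_iff.2 e.2) disjoint_sdiff_self_left (span_le_closedSpan _ hrest)
    (Submodule.smul_mem _ (c e) (Submodule.mem_span_singleton_self (e : V)))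
  rwa [Finset.sum_erase_add F _ (hF (Finset.mem_singleton_self e)), norm_smul,
    hT.norm_eq_one e e.2, mul_one] at hle

variable [CompleteSpace V] [CompleteSpace k]

theorem IsOrthonormalSet.isOrthonormalSchauderBasis {T : Set V} (hT : IsOrthonormalSet k T)
    (htop : closedSpan (k := k) T = ⊤) : IsOrthonormalSchauderBasis k T where
  norm_eq_one := hT.norm_eq_one
  norm_sum c hc := by
    have hnorm (e : T) : ‖c e • (e : V)‖ = ‖c e‖ := by
      rw [norm_smul, hT.norm_eq_one e e.2, mul_one]
    obtain ⟨s, hs⟩ := NonarchimedeanAddGroup.summable_of_tendsto_cofinite_zero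
      (f := fun e : T => c e • (e : V))
      (tendsto_zero_iff_norm_tendsto_zero.2 (by simpa only [hnorm, norm_zero] using hc.norm))
    refine ⟨s, hs, le_antisymm ?_ ?_⟩
    · exact norm_le_of_hasSum hs (Real.iSup_nonneg fun _ => norm_nonneg _) fun e =>
        (hnorm e).trans_le (le_ciSup hc.norm.bddAbove_range_of_cofinite e)
    · exact Real.iSup_le (hT.norm_apply_le_of_hasSum hs) (norm_nonneg _)
  exists_sum x := by
    have hx : x ∈ closedSpan (k := k) T := htop ▸ Submodule.mem_top
    refine ⟨fun e => hT.coord e x,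
      (hT.tendsto_coord hx).comp Subtype.val_injective.tendsto_cofinite, ?_⟩
    refine (hasSum_subtype_iff_of_support_subset (f := fun e => hT.coord e x • e)
      fun e he => ?_).2 (hT.hasSum_coord_smul hx)
    by_contra heT
    exact left_ne_zero_of_smul he (hT.coord_eq_zero_of_subset subset_rfl heT hx)

theorem isFree_iff :
    IsFree k V ↔ ∃ T : Set V, IsOrthonormalSet k T ∧ closedSpan (k := k) T = ⊤ :=
  ⟨fun ⟨E, hE⟩ => ⟨E, hE.isOrthonormalSet, hE.closedSpan_eq_top⟩,
    fun ⟨T, hT, htop⟩ => ⟨T, hT.isOrthonormalSchauderBasis htop⟩⟩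

theorem isFree_closedSpan_iff {S : Set V} : IsFree k (closedSpan (k := k) S) ↔
    ∃ T : Set V, IsOrthonormalSet k T ∧ closedSpan (k := k) T = closedSpan S := by
  have : CompleteSpace (closedSpan (k := k) S) := (isClosed_closedSpan S).completeSpace_coe
  set f := (closedSpan (k := k) S).subtypeₗᵢ
  rw [isFree_iff]
  constructor
  · rintro ⟨T, hT, htop⟩
    refine ⟨f '' T, (isOrthonormalSet_image_iff f).2 hT, le_antisymm ?_ fun x hx => ?_⟩
    · refine closedSpan_le (isClosed_closedSpan S) ?_
      rintro _ ⟨t, -, rfl⟩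
      exact t.2
    · exact (map_mem_closedSpan_image_iff f (x := ⟨x, hx⟩)).2 (htop ▸ Submodule.mem_top)
  · rintro ⟨T, hT, hTS⟩
    have himage : f '' (f ⁻¹' T) = T :=
      Set.image_preimage_eq_of_subset fun t ht => ⟨⟨t, hTS.le (subset_closedSpan T ht)⟩, rfl⟩
    refine ⟨f ⁻¹' T, ?_, eq_top_iff.2 fun x _ => ?_⟩
    · rwa [← isOrthonormalSet_image_iff f, himage]
    · rw [← map_mem_closedSpan_image_iff f, himage, hTS]
      exact x.2

theorem isRelSubfree_bot_of_isFree_closedSpan {S : Set V}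
    (h : IsFree k (closedSpan (k := k) S)) : IsRelSubfree ⊥ (closedSpan (k := k) S) := by
  obtain ⟨T, hT, hTS⟩ := isFree_closedSpan_iff.1 h
  simpa only [closedSpan_empty, hTS] using hT.isRelSubfree_of_subset (Set.empty_subset T)

end Free

section Subfree

variable {k : Type u} [NontriviallyNormedField k] [IsUltrametricDist k] [CompleteSpace k]
  {V : Type v} [NormedAddCommGroup V] [NormedSpace k V] [IsUltrametricDist V] [CompleteSpace V]

theorem isFree_closedSpan_of_isRelSubfree {S : Set V}
    (h : IsRelSubfree ⊥ (closedSpan (k := k) S)) : IsFree k (closedSpan (k := k) S) := by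
  obtain ⟨I, φ, hφ⟩ := h
  rw [← closedSpan_empty] at hφ
  obtain ⟨T, -, hT, hTS⟩ := hφ.exists_extend (isClosed_closedSpan S) .empty
  exact isFree_closedSpan_iff.2 ⟨T, hT, hTS⟩

theorem IsCoordSystem.isFree {I : Type w} {φ : I → V →ₗ[k] k}
    (h : IsCoordSystem φ ⊥ (⊤ : Submodule k V)) : IsFree k V := by
  rw [← closedSpan_empty] at h
  obtain ⟨T, -, hT, htop⟩ := h.exists_extend isClosed_univ .empty
  exact isFree_iff.2 ⟨T, hT, htop⟩

theorem IsFree.isFree_closedSpan (h : IsFree k V) (S : Set V) :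
    IsFree k (closedSpan (k := k) S) := by
  obtain ⟨T, hT, htop⟩ := isFree_iff.1 h
  have hsub := hT.isRelSubfree_of_subset (Set.empty_subset T)
  rw [closedSpan_empty, htop] at hsub
  exact isFree_closedSpan_of_isRelSubfree (hsub.restrict bot_le le_top)

end Subfree

section TrivialValuation

variable {k : Type u} [NormedField k] {V : Type v} [NormedAddCommGroup V] [NormedSpace k V]
  [IsUltrametricDist V]

theorem norm_eq_one_of_isFree (hk : ∀ c : k, ‖c‖ ≤ 1) (h : IsFree k V) {x : V} (hx : x ≠ 0) :
    ‖x‖ = 1 := by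
  obtain ⟨E, hE⟩ := h
  obtain ⟨c, -, hc⟩ := hE.exists_sum x
  refine le_antisymm (norm_le_of_hasSum hc zero_le_one fun e => ?_) ?_
  · rw [norm_smul, hE.norm_eq_one e e.2, mul_one]
    exact hk _
  · obtain ⟨e, he⟩ : ∃ e, c e ≠ 0 := by
      by_contra! h₀
      simp only [h₀, zero_smul] at hc
      exact hx (hc.unique hasSum_zero)
    have hinv : ‖c e‖⁻¹ ≤ 1 := norm_inv (c e) ▸ hk (c e)⁻¹
    exact ((inv_le_one₀ (norm_pos_iff.2 he)).1 hinv).trans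
      (hE.isOrthonormalSet.norm_apply_le_of_hasSum hc e)

variable [CompleteSpace k] [CompleteSpace V]

theorem isFree_of_norm_eq_one (h : ∀ x : V, x ≠ 0 → ‖x‖ = 1) : IsFree k V := by
  set T := Module.Basis.ofVectorSpaceIndex k V
  have hli : LinearIndepOn k id T := Module.Basis.ofVectorSpaceIndex.linearIndependent k V
  have hspan : Submodule.span k T = ⊤ := by
    simpa using (Module.Basis.ofVectorSpace k V).span_eq
  refine isFree_iff.2 ⟨T, ⟨fun e he => h e (hli.ne_zero he), fun l hl e => ?_⟩,
    top_le_iff.1 (hspan ▸ span_le_closedSpan T)⟩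
  by_cases hl₀ : Finsupp.linearCombination k id l = 0
  · rw [linearIndepOn_iff.1 hli l hl hl₀]
    simp
  · by_cases hle : l e = 0
    · simp [hle]
    · simpa [norm_smul, h _ hl₀] using (h _ (smul_ne_zero hle hl₀)).le

theorem isFree_iff_isAlmostFree_of_trivial (hk : ∀ c : k, ‖c‖ ≤ 1) (hrank : 1 < rank k V) :
    IsFree k V ↔ IsAlmostFree k V := by
  have hcomplete (S : Set V) : CompleteSpace (closedSpan (k := k) S) :=
    (isClosed_closedSpan S).completeSpace_coe
  refine ⟨fun h S _ => ?_, fun h => ?_⟩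
  · exact isFree_of_norm_eq_one fun x hx =>
      norm_eq_one_of_isFree (k := k) hk h (x := (x : V)) (by simpa using hx)
  · refine isFree_of_norm_eq_one fun x hx => ?_
    exact norm_eq_one_of_isFree hk (h {x} (by rwa [mk_singleton]))
      (x := ⟨x, subset_closedSpan {x} rfl⟩) (by simpa using hx)

end TrivialValuation

section FineUltrafilter

theorem IsStronglyCompactCard.exists_fine_ultrafilter {lam : Cardinal.{max u v}} {S : Type v}
    (h : IsStronglyCompactCard lam (lift.{u} #S)) (hS : (#S).IsRegular) :
    ∃ (X : Type (max u v)) (U : Ultrafilter X) (A : X → Set S),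
      CardinalInterFilter (U : Filter X) lam ∧ (∀ x, #(A x) < #S) ∧ ∀ s, ∀ᶠ x in U, s ∈ A x := by
  obtain ⟨_, _, hord⟩ := exists_ord_eq_type_lt S
  have hX : #(ULift.{u} S) = lift.{u} #S := mk_uLift S
  obtain ⟨U, hU, hle⟩ := h.2 _ hX (cocardinal _ hS.lift) (by
    rw [neBot_iff, Ne, ← empty_mem_iff_bot, mem_cocardinal, Set.compl_empty, mk_univ, hX]
    exact lt_irrefl _) inferInstance
  refine ⟨_, U, fun x => Set.Iio x.down, hU, fun x => mk_Iio_lt x.down hord, fun s => hle ?_⟩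
  have hcompl : {x : ULift.{u} S | s ∈ Set.Iio x.down}ᶜ = ULift.down ⁻¹' Set.Iic s := by
    ext x
    exact not_lt (a := s) (b := x.down)
  rw [mem_cocardinal, hcompl, mk_preimage_down, lift_lt]
  exact mk_Iic_lt s hord hS.aleph0_le

theorem exists_eventually_eq_const {X : Type w} {Y : Type v} {U : Ultrafilter X}
    {c : Cardinal.{w}} (hU : CardinalInterFilter (U : Filter X) c)
    (hY : lift.{w} #Y < lift.{v} c) (g : X → Y) : ∃ y, ∀ᶠ x in U, g x = y := by
  by_contra! h
  have hcard : #(Set.range fun y : Y => {x | g x ≠ y}) < c := by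
    rw [← lift_lt.{w, v}]
    exact mk_range_le_lift.trans_lt hY
  obtain ⟨x, hx⟩ := U.neBot.nonempty_of_mem (hU.cardinal_sInter_mem _ hcard (by
    rintro _ ⟨y, rfl⟩
    exact h y))
  exact hx _ ⟨g x, rfl⟩ rfl

end FineUltrafilter

section Ultraproduct

variable {X : Type w} {U : Ultrafilter X}

theorem finite_of_eventually_out_mem (hU : ∀ g : X → ℕ, ∃ n, ∀ᶠ x in U, g x = n)
    {I : X → Type*} {P : ∀ x, Set (I x)} (hP : ∀ᶠ x in U, (P x).Finite)
    {Q : Set ((U : Filter X).Product I)} (hQ : ∀ q ∈ Q, ∀ᶠ x in U, q.out x ∈ P x) :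
    Q.Finite := by
  classical
  by_contra hinf
  obtain ⟨n, hn⟩ := hU fun x => (P x).ncard
  obtain ⟨s, hsQ, hs⟩ := Set.Infinite.exists_subset_card_eq hinf (n + 1)
  have hmem : ∀ᶠ x in U, ∀ q ∈ s, q.out x ∈ P x :=
    (Filter.eventually_all_finset s).2 fun q hq => hQ q (hsQ hq)
  have hinj : ∀ᶠ x in U, ∀ q ∈ s, ∀ q' ∈ s, q.out x = q'.out x → q = q' := by
    refine (Filter.eventually_all_finset s).2 fun q _ =>
      (Filter.eventually_all_finset s).2 fun q' _ => ?_
    by_cases hqq' : q = q'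
    · exact Eventually.of_forall fun _ _ => hqq'
    · have hne : ¬ ∀ᶠ x in (U : Filter X), q.out x = q'.out x := fun heq => hqq' <| by
        rw [← q.out_eq, ← q'.out_eq]
        exact Quotient.sound heq
      exact (Ultrafilter.eventually_not.2 hne).mono fun x hx hx' => absurd hx' hx
  obtain ⟨x, hfin, hx, hmem, hinj⟩ := (hP.and (hn.and (hmem.and hinj))).exists
  have hcard : (s.image fun q => q.out x).card ≤ n := by
    rw [← hx, ← Set.ncard_coe_finset]
    refine Set.ncard_le_ncard (fun i hi => ?_) hfin
    obtain ⟨q, hq, rfl⟩ := Finset.mem_image.1 hi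
    exact hmem q hq
  rw [Finset.card_image_of_injOn fun q hq q' hq' => hinj q hq q' hq', hs] at hcard
  exact absurd hcard (Nat.not_succ_le_self n)

section

variable {k : Type u} [NormedField k] {V : Type v} [NormedAddCommGroup V] [NormedSpace k V]

theorem IsRelSubfree.exists_nonempty {A B : Submodule k V} (h : IsRelSubfree A B) :
    ∃ (I : Type v) (_ : Nonempty I) (φ : I → V →ₗ[k] k), IsCoordSystem φ A B := by
  obtain ⟨I, φ, h⟩ := h
  rcases isEmpty_or_nonempty I with hI | hI
  · exact ⟨PUnit, inferInstance, fun _ => 0, h.le, fun b _ => tendsto_const_nhds, by simp,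
      by simp, fun b hb => (h.exists_norm_sub_le b hb).imp fun a ha =>
        ⟨ha.1, fun r hr _ => ha.2 r hr isEmptyElim⟩⟩
  · exact ⟨I, hI, φ, h⟩

theorem IsCoordSystem.exists_norm_eq {I : Type w} [Nonempty I] {φ : I → V →ₗ[k] k}
    {B : Submodule k V} (h : IsCoordSystem φ ⊥ B) {b : V} (hb : b ∈ B) : ∃ i, ‖φ i b‖ = ‖b‖ := by
  obtain ⟨a, ha, hle⟩ := h.exists_norm_sub_le b hb
  rw [(Submodule.mem_bot k).1 ha, sub_zero] at hle
  by_cases h₀ : ∃ i ∈ Set.univ, φ i b ≠ 0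
  · obtain ⟨i, -, -, hi⟩ := exists_norm_max (h.tendsto b hb) h₀
    exact ⟨i, (h.norm_le b hb i).antisymm (hle _ (norm_nonneg _) fun j => hi j trivial)⟩
  · push Not at h₀
    have hb₀ : b = 0 := norm_le_zero_iff.1 (hle 0 le_rfl fun i => by rw [h₀ i trivial, norm_zero])
    exact ⟨Classical.arbitrary I, by rw [hb₀, map_zero, norm_zero, norm_zero]⟩

end

variable {k : Type u} [NontriviallyNormedField k] [IsUltrametricDist k] [CompleteSpace k]

theorem exists_tendsto_of_eventually_mk_eq_const
    (hU : ∀ g : X → k ⧸ integers k, ∃ y, ∀ᶠ x in U, g x = y) (g : X → k) :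
    ∃ a, Tendsto g U (𝓝 a) := by
  refine CompleteSpace.complete (Metric.cauchy_iff.2 ⟨inferInstance, fun ε hε => ?_⟩)
  obtain ⟨c, hc₀, hcε⟩ := NormedField.exists_norm_lt k hε
  obtain ⟨y, hy⟩ := hU fun x => (c⁻¹ * g x : k)
  refine ⟨_, image_mem_map hy, ?_⟩
  rintro _ ⟨x, hx, rfl⟩ _ ⟨x', hx', rfl⟩
  have hint : ‖-(c⁻¹ * g x') + c⁻¹ * g x‖ ≤ 1 := QuotientAddGroup.eq.1
    ((Set.mem_ofPred_eq.to_iff.1 hx').trans (Set.mem_ofPred_eq.to_iff.1 hx).symm)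
  have hdiff : g x - g x' = c * (-(c⁻¹ * g x') + c⁻¹ * g x) := by
    have hc : c ≠ 0 := norm_pos_iff.1 hc₀
    field_simp
    ring
  rw [dist_eq_norm, hdiff, norm_mul]
  exact (mul_le_of_le_one_right (norm_nonneg _) hint).trans_lt hcε

variable {V : Type v} [NormedAddCommGroup V] [NormedSpace k V]

theorem exists_linearMap_tendsto (hU : ∀ g : X → k ⧸ integers k, ∃ y, ∀ᶠ x in U, g x = y)
    (f : X → V →ₗ[k] k) : ∃ F : V →ₗ[k] k, ∀ v, Tendsto (fun x => f x v) U (𝓝 (F v)) := by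
  choose L hL using fun v => exists_tendsto_of_eventually_mk_eq_const hU fun x => f x v
  refine ⟨⟨⟨L, fun v w => ?_⟩, fun c v => ?_⟩, hL⟩
  · exact tendsto_nhds_unique (hL _)
      (((hL v).add (hL w)).congr fun x => (map_add (f x) v w).symm)
  · exact tendsto_nhds_unique (hL _)
      (((hL v).const_smul c).congr fun x => (map_smul (f x) c v).symm)

theorem exists_isCoordSystem_of_eventually_mem
    (hU : ∀ g : X → k ⧸ integers k, ∃ y, ∀ᶠ x in U, g x = y)
    (hU' : ∀ g : X → ℕ, ∃ n, ∀ᶠ x in U, g x = n) {B : X → Submodule k V}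
    (hB : ∀ x, IsRelSubfree ⊥ (B x)) (hmem : ∀ v, ∀ᶠ x in U, v ∈ B x) :
    ∃ (I : Type (max v w)) (φ : I → V →ₗ[k] k), IsCoordSystem φ ⊥ ⊤ := by
  choose I hI φ hφ using fun x => (hB x).exists_nonempty
  choose ψ hψ using fun q : (U : Filter X).Product I =>
    exists_linearMap_tendsto hU fun x => φ x (q.out x)
  refine ⟨_, ψ, bot_le, fun v _ => Metric.tendsto_nhds.2 fun ε hε => ?_, fun v _ q => ?_, ?_,
    fun v _ => ⟨0, Submodule.zero_mem _, fun r _ hle => ?_⟩⟩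
  · refine finite_of_eventually_out_mem hU' (P := fun x => {i | ε / 2 ≤ ‖φ x i v‖})
      ((hmem v).mono fun x hx => finite_setOf_le_norm ((hφ x).tendsto v hx) (half_pos hε))
      fun q hq => ?_
    have hq' : ε ≤ ‖ψ q v‖ := by simpa using hq
    exact ((hψ q v).norm.eventually_const_lt ((half_lt_self hε).trans_le hq')).mono
      fun x hx => hx.le
  · exact le_of_tendsto (hψ q v).norm ((hmem v).mono fun x hx => (hφ x).norm_le v hx _)
  · intro a ha q
    rw [(Submodule.mem_bot k).1 ha, map_zero]
  · have hattained (x : X) : ∃ i, v ∈ B x → ‖φ x i v‖ = ‖v‖ := by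
      by_cases hx : v ∈ B x
      · exact ((hφ x).exists_norm_eq hx).imp fun i hi _ => hi
      · exact ⟨Classical.arbitrary _, fun hx' => absurd hx' hx⟩
    choose f hf using hattained
    let q : (U : Filter X).Product I := Quotient.mk (productSetoid _ _) f
    have hq : ∀ᶠ x in (U : Filter X), q.out x = f x := Quotient.mk_out (s := productSetoid _ _) f
    have hlim : Tendsto (fun x => ‖φ x (q.out x) v‖) U (𝓝 ‖v‖) := by
      refine tendsto_nhds_of_eventually_eq ?_
      filter_upwards [hq, hmem v] with x hx hxv
      rw [hx, hf x hxv]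
    rw [sub_zero, ← tendsto_nhds_unique (hψ q v).norm hlim]
    exact hle q

theorem IsCardFree.isFree_of_isRegular [IsUltrametricDist V] [CompleteSpace V] {G : Set V}
    (hG : closedSpan (k := k) G = ⊤)
    (hcompact : IsStronglyCompactCard (lift.{v} (lambdaCard k)) (lift.{u} #G))
    (hreg : (#G).IsRegular) (h : IsCardFree k V #G) : IsFree k V := by
  obtain ⟨X, U, A, hU, hA, hfine⟩ := hcompact.exists_fine_ultrafilter hreg
  have hlam : max #(k ⧸ integers k) ℵ₀ < lambdaCard k := Order.lt_succ _
  have hω : ℵ₀ < lift.{v} (lambdaCard k) :=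
    aleph0_lt_lift.2 ((le_max_right _ _).trans_lt hlam)
  have hUc := CardinalInterFilter.toCountableInterFilter (U : Filter X) hω
  have hmem (v : V) : ∀ᶠ x in U, v ∈ closedSpan (k := k) ((↑) '' A x : Set V) := by
    obtain ⟨C, hCG, hC, hvC⟩ :=
      exists_countable_mem_closedSpan (hG ▸ Submodule.mem_top : v ∈ closedSpan (k := k) G)
    have hCA : ∀ᶠ x in (U : Filter X), ∀ c (hc : c ∈ C), (⟨c, hCG hc⟩ : G) ∈ A x :=
      (eventually_countable_ball hC).2 fun c hc => hfine _
    refine hCA.mono fun x hx => closedSpan_mono (fun c hc => ?_) hvC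
    exact ⟨⟨c, hCG hc⟩, hx c hc, rfl⟩
  obtain ⟨I, φ, hφ⟩ := exists_isCoordSystem_of_eventually_mem
    (exists_eventually_eq_const hU (by
      simpa [lift_umax.{u, v}] using (le_max_left _ _).trans_lt hlam))
    (exists_eventually_eq_const hU (by simpa using (le_max_right _ _).trans_lt hlam))
    (fun x => isRelSubfree_bot_of_isFree_closedSpan (h _ (mk_image_le.trans_lt (hA x)))) hmem
  exact hφ.isFree

end Ultraproduct

section ClosingOff

variable {α : Type v} {ν : Cardinal.{v}}

theorem mk_biUnion_le_of_forall_le {ι : Type v} (hν : ℵ₀ ≤ ν) {s : Set ι} (hs : #s ≤ ν)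
    {A : ι → Set α} (hA : ∀ i ∈ s, #(A i) ≤ ν) : #(⋃ i ∈ s, A i) ≤ ν :=
  (mk_biUnion_le A s).trans ((mul_le_mul' hs (ciSup_le' fun i : s => hA i i.2)).trans
    (mul_eq_self hν).le)

theorem mk_union_le_of_le (hν : ℵ₀ ≤ ν) {S T : Set α} (hS : #S ≤ ν) (hT : #T ≤ ν) :
    #(S ∪ T : Set α) ≤ ν :=
  (mk_union_le S T).trans (add_le_of_le hν hS hT)

/-- The increasing chain of sets obtained from `X₀` by transfinitely often adjoining `W S` for
all the sets `S` reached before. -/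
noncomputable def adjoinChain (W : Set α → Set α) (X₀ : Set α) (o : Ordinal.{v}) : Set α :=
  X₀ ∪ ⋃ b : Set.Iio o, W (adjoinChain W X₀ b)
termination_by o
decreasing_by exact b.2

variable {W : Set α → Set α} {X₀ : Set α}

theorem mem_adjoinChain {o : Ordinal.{v}} {x : α} :
    x ∈ adjoinChain W X₀ o ↔ x ∈ X₀ ∨ ∃ b < o, x ∈ W (adjoinChain W X₀ b) := by
  rw [adjoinChain]
  simp

theorem adjoinChain_mono : Monotone (adjoinChain W X₀) := fun a b hab x hx => by
  rw [mem_adjoinChain] at hx ⊢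
  exact hx.imp_right fun ⟨c, hc, hxc⟩ => ⟨c, hc.trans_le hab, hxc⟩

theorem mk_adjoinChain_le (hν : ℵ₀ ≤ ν) (hX₀ : #X₀ ≤ ν) (hW : ∀ S, #(W S) ≤ ν) {o : Ordinal.{v}}
    (ho : o.card ≤ ν) : #(adjoinChain W X₀ o) ≤ ν := by
  have heq : adjoinChain W X₀ o = X₀ ∪ ⋃ b < o, W (adjoinChain W X₀ b) := by
    ext x
    simp [mem_adjoinChain]
  rw [heq]
  exact mk_union_le_of_le hν hX₀ (mk_biUnion_le_of_le ho hν _ fun b _ => hW _)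

theorem exists_subset_adjoinChain {κ : Cardinal.{v}} (hκ : κ.IsRegular) {R : Set α}
    (hR : R ⊆ adjoinChain W X₀ κ.ord) (hRκ : #R < κ) :
    ∃ b < κ.ord, R ⊆ adjoinChain W X₀ b := by
  have hlevel : ∀ x : R, ∃ b < κ.ord, (x : α) ∈ adjoinChain W X₀ b := by
    intro x
    rcases mem_adjoinChain.1 (hR x.2) with hx | ⟨b, hb, hx⟩
    · exact ⟨0, hκ.ord_pos, mem_adjoinChain.2 (.inl hx)⟩
    · exact ⟨Order.succ b, (isSuccLimit_ord hκ.aleph0_le).succ_lt hb,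
        mem_adjoinChain.2 (.inr ⟨b, Order.lt_succ b, hx⟩)⟩
  choose β hβ hxβ using hlevel
  exact ⟨⨆ x, β x, Ordinal.iSup_lt_of_lt_cof (by rwa [hκ.cof_ord]) hβ,
    fun x hx => adjoinChain_mono (Ordinal.le_iSup β ⟨x, hx⟩) (hxβ ⟨x, hx⟩)⟩

theorem adjoinChain_nfp_subset {f : Ordinal.{v} → Ordinal.{v}} {o : Ordinal.{v}} :
    adjoinChain W X₀ (Ordinal.nfp f o) ⊆ ⋃ n, adjoinChain W X₀ (f^[n] o) := by
  intro x hx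
  rcases mem_adjoinChain.1 hx with hx | ⟨b, hb, hx⟩
  · exact Set.mem_iUnion.2 ⟨0, mem_adjoinChain.2 (.inl hx)⟩
  · obtain ⟨n, hn⟩ := Ordinal.lt_nfp_iff.1 hb
    exact Set.mem_iUnion.2 ⟨n, mem_adjoinChain.2 (.inr ⟨b, hn, hx⟩)⟩

/-- A closing-off argument: the set `U` does not depend on the closure condition `c`. -/
theorem exists_superset_forall_exists_closed (hν : ℵ₀ ≤ ν) (hX₀ : #X₀ ≤ ν)
    (hW : ∀ S, #(W S) ≤ ν) :
    ∃ U : Set α, #U ≤ Order.succ ν ∧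
      ∀ c : α → Set α, (∀ x ∈ U, c x ⊆ U) → (∀ x ∈ U, #(c x) ≤ ν) →
        ∃ S ⊆ U, X₀ ⊆ S ∧ #S ≤ ν ∧ W S ⊆ U ∧ ∀ x ∈ S, c x ⊆ S := by
  set κ := Order.succ ν
  have hκ : κ.IsRegular := isRegular_succ hν
  have hcard (b) (hb : b < κ.ord) : #(adjoinChain W X₀ b) ≤ ν :=
    mk_adjoinChain_le hν hX₀ hW (Order.lt_succ_iff.1 (lt_ord.1 hb))
  refine ⟨adjoinChain W X₀ κ.ord, ?_, fun c hcU hcν => ?_⟩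
  · exact mk_adjoinChain_le hκ.aleph0_le (hX₀.trans (Order.le_succ ν))
      (fun S => (hW S).trans (Order.le_succ ν)) (card_ord κ).le
  have hnext : ∀ b < κ.ord, ∃ b' < κ.ord,
      ⋃ x ∈ adjoinChain W X₀ b, c x ⊆ adjoinChain W X₀ b' := by
    intro b hb
    have hbU := adjoinChain_mono (W := W) (X₀ := X₀) hb.le
    exact exists_subset_adjoinChain hκ (Set.iUnion₂_subset fun x hx => hcU x (hbU hx))
      (Order.lt_succ_iff.2 (mk_biUnion_le_of_forall_le hν (hcard b hb)
        fun x hx => hcν x (hbU hx)))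
  choose! f hfκ hf using hnext
  have hlt : Ordinal.nfp f 0 < κ.ord :=
    nfp_lt_ord_of_isRegular hκ (hν.trans_lt (Order.lt_succ ν)).ne' hfκ hκ.ord_pos
  refine ⟨adjoinChain W X₀ (Ordinal.nfp f 0), adjoinChain_mono hlt.le,
    fun x hx => mem_adjoinChain.2 (.inl hx), hcard _ hlt,
    fun x hx => mem_adjoinChain.2 (.inr ⟨_, hlt, hx⟩), fun x hx => ?_⟩
  obtain ⟨n, hn⟩ := Set.mem_iUnion.1 (adjoinChain_nfp_subset hx)
  have hcx : c x ⊆ adjoinChain W X₀ (f^[n + 1] 0) := by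
    rw [Function.iterate_succ_apply']
    exact (Set.subset_biUnion_of_mem (u := c) hn).trans
      (hf _ ((Ordinal.iterate_le_nfp f 0 n).trans_lt hlt))
  exact hcx.trans (adjoinChain_mono (Ordinal.iterate_le_nfp f 0 (n + 1)))

theorem exists_cofinal_family_of_isSingular (hsing : (#α).IsSingular) :
    ∃ (ι : Type v) (_ : LinearOrder ι) (_ : WellFoundedLT ι) (ν : ι → Cardinal.{v})
      (Y : ι → Set α), Monotone ν ∧ (∀ i, ℵ₀ ≤ ν i) ∧ (∀ i, #ι ≤ ν i) ∧ (∀ i, ν i < #α) ∧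
        (∀ i, #(Y i) ≤ ν i) ∧ ⋃ i, Y i = Set.univ := by
  obtain ⟨_, _, hord⟩ := exists_ord_eq_type_lt α
  obtain ⟨s, hs, hscard⟩ := Order.exists_cof_eq α
  have hω : ℵ₀ < #α := hsing.aleph0_le.lt_of_ne fun h => not_isSingular_aleph0 (h ▸ hsing)
  have hslt : #s < #α := by
    rw [hscard, ← Ordinal.cof_type, ← hord]
    exact hsing.cof_ord_lt
  refine ⟨s, inferInstance, inferInstance, fun i => max ℵ₀ (max #s #(Set.Iic i.1)),
    fun i => Set.Iic i.1, fun i j hij => ?_, fun i => le_max_left _ _, fun i => ?_, fun i => ?_,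
    fun i => ?_, Set.eq_univ_of_forall fun x => ?_⟩
  · exact max_le_max le_rfl (max_le_max le_rfl (mk_le_mk_of_subset (Set.Iic_subset_Iic.2 hij)))
  · exact (le_max_left _ _).trans (le_max_right _ _)
  · exact max_lt hω (max_lt hslt (mk_Iic_lt i.1 hord hω.le))
  · exact (le_max_right _ _).trans (le_max_right _ _)
  · obtain ⟨i, hi, hxi⟩ := hs x
    exact Set.mem_iUnion.2 ⟨⟨i, hi⟩, hxi⟩

end ClosingOff

section Singular

variable {k : Type u} [NormedField k] {V : Type v} [NormedAddCommGroup V] [NormedSpace k V]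
  {κ ν : Cardinal.{v}}

variable (k) in
/-- A countable subset of `T` whose closed span contains `x`; it is `∅` if `x` does not lie in the
closed span of `T`. -/
noncomputable def spanSupport (T : Set V) (x : V) : Set V :=
  open Classical in
  if h : x ∈ closedSpan (k := k) T then (exists_countable_mem_closedSpan h).choose else ∅

theorem spanSupport_subset (T : Set V) (x : V) : spanSupport k T x ⊆ T := by
  unfold spanSupport
  split_ifs with h
  · exact (exists_countable_mem_closedSpan h).choose_spec.1
  · exact Set.empty_subset T

theorem mk_spanSupport_le (hν : ℵ₀ ≤ ν) (T : Set V) (x : V) : #(spanSupport k T x) ≤ ν := by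
  refine le_trans (le_aleph0_iff_set_countable.2 ?_) hν
  unfold spanSupport
  split_ifs with h
  · exact (exists_countable_mem_closedSpan h).choose_spec.2.1
  · exact Set.countable_empty

theorem mem_closedSpan_spanSupport {T : Set V} {x : V} (h : x ∈ closedSpan (k := k) T) :
    x ∈ closedSpan (k := k) (spanSupport k T x) := by
  rw [spanSupport, dif_pos h]
  exact (exists_countable_mem_closedSpan h).choose_spec.2.2

theorem subset_closedSpan_biUnion_spanSupport {S T : Set V} (h : S ⊆ closedSpan (k := k) T) :
    S ⊆ closedSpan (k := k) (⋃ x ∈ S, spanSupport k T x) := fun _ hx =>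
  closedSpan_mono (Set.subset_biUnion_of_mem (u := spanSupport k T) hx)
    (mem_closedSpan_spanSupport (h hx))

variable [IsUltrametricDist V]

namespace IsOrthonormalSet

variable {S T T₁ : Set V}

theorem mem_of_mem_closedSpan (hT : IsOrthonormalSet k T) (h₁ : T₁ ⊆ T) {e : V} (he : e ∈ T)
    (h : e ∈ closedSpan (k := k) T₁) : e ∈ T₁ := by
  by_contra hcon
  have hle := hT.norm_le_norm_add_of_disjoint h₁ (Set.singleton_subset_iff.2 he)
    (Set.disjoint_singleton_right.2 hcon) (Submodule.neg_mem _ h)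
    (Submodule.mem_span_singleton_self e)
  rw [neg_add_cancel, norm_zero, hT.norm_eq_one e he] at hle
  exact absurd hle (not_le.2 one_pos)

theorem mk_le (hT : IsOrthonormalSet k T) (hν : ℵ₀ ≤ ν)
    (hTS : closedSpan (k := k) T = closedSpan (k := k) S) (hS : #S ≤ ν) : #T ≤ ν := by
  have hST : S ⊆ closedSpan (k := k) T := hTS ▸ subset_closedSpan S
  have hsub : (⋃ s ∈ S, spanSupport k T s) ⊆ T :=
    Set.iUnion₂_subset fun s _ => spanSupport_subset T s
  have hle : T ⊆ ⋃ s ∈ S, spanSupport k T s := fun t ht =>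
    hT.mem_of_mem_closedSpan hsub ht (closedSpan_le_closedSpan
      (subset_closedSpan_biUnion_spanSupport hST) (hTS ▸ subset_closedSpan T ht))
  exact (mk_le_mk_of_subset hle).trans
    (mk_biUnion_le_of_forall_le hν hS fun s _ => mk_spanSupport_le hν T s)

end IsOrthonormalSet

theorem exists_isOrthonormalSet_of_filtration {ι : Type w} [LinearOrder ι] [WellFoundedLT ι]
    {B : ι → Set V} (hB : ∀ i, IsOrthonormalSet k (B i))
    (hsplit : ∀ i j, i < j → B i ⊆ closedSpan (k := k) (B j ∩ closedSpan (k := k) (B i))) :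
    ∃ D : Set V, IsOrthonormalSet k D ∧ ∀ i, B i ⊆ closedSpan (k := k) D := by
  let D (j : ι) : Set V := B j \ ⋃ i < j, (closedSpan (k := k) (B i) : Set V)
  have hDB (j) : D j ⊆ B j := Set.sdiff_subset
  have hDorth (j) : IsOrthonormalSet k (D j) := (hB j).mono (hDB j)
  refine ⟨⋃ j, D j, .iUnion_of_orthogonal hDorth fun j y hy z hz => ?_, fun j => ?_⟩
  · have hsub : (⋃ i < j, D i) ⊆ closedSpan (k := k)
        (B j ∩ ⋃ i < j, (closedSpan (k := k) (B i) : Set V)) := by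
      refine Set.iUnion₂_subset fun i hi x hx => closedSpan_mono ?_ (hsplit i j hi (hDB i hx))
      exact Set.inter_subset_inter_right _ (Set.subset_biUnion_of_mem
        (u := fun i => (closedSpan (k := k) (B i) : Set V)) hi)
    exact (hB j).norm_le_norm_add_of_disjoint Set.inter_subset_left (hDB j)
      (Set.disjoint_left.2 fun x hx hxD => hxD.2 hx.2) (Submodule.span_le.2 hsub hy) hz
  · induction j using WellFoundedLT.induction with
    | ind j ih =>
      intro x hx
      by_cases hxj : x ∈ ⋃ i < j, (closedSpan (k := k) (B i) : Set V)
      · obtain ⟨i, hi, hxi⟩ := Set.mem_iUnion₂.1 hxj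
        exact closedSpan_le_closedSpan (ih i hi) hxi
      · exact subset_closedSpan _ (Set.mem_iUnion.2 ⟨j, hx, hxj⟩)

variable [CompleteSpace k] [CompleteSpace V]

theorem IsCardFree.exists_saturated_superset (h : IsCardFree k V κ) (hν : ℵ₀ ≤ ν)
    (hνκ : Order.succ ν < κ) {X₀ : Set V} (hX₀ : #X₀ ≤ ν) :
    ∃ S : Set V, X₀ ⊆ S ∧ #S ≤ ν ∧ ∀ X : Set V, #X ≤ ν →
      IsRelSubfree (closedSpan (k := k) S) (closedSpan (k := k) (S ∪ X)) := by
  have hworst : ∀ S : Set V, ∃ X : Set V, #X ≤ ν ∧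
      (IsRelSubfree (closedSpan (k := k) S) (closedSpan (k := k) (S ∪ X)) →
        ∀ Y : Set V, #Y ≤ ν →
          IsRelSubfree (closedSpan (k := k) S) (closedSpan (k := k) (S ∪ Y))) := by
    intro S
    by_contra! H
    obtain ⟨-, X, hX, hnot⟩ := H ∅ (by simp)
    obtain ⟨hrel, -⟩ := H X hX
    exact hnot hrel
  choose W hWν hW using hworst
  obtain ⟨U, hUν, hU⟩ := exists_superset_forall_exists_closed hν hX₀ hWν
  obtain ⟨T, hT, hTU⟩ := isFree_closedSpan_iff.1 (h U (hUν.trans_lt hνκ))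
  have hUT : U ⊆ closedSpan (k := k) T := hTU ▸ subset_closedSpan U
  have hTU' : T ⊆ closedSpan (k := k) U := hTU ▸ subset_closedSpan T
  obtain ⟨S, hSU, hX₀S, hSν, hWS, hclosed⟩ := hU
    (fun x => ⋃ t ∈ spanSupport k T x, spanSupport k U t)
    (fun x _ => Set.iUnion₂_subset fun t _ => spanSupport_subset U t)
    (fun x _ => mk_biUnion_le_of_forall_le hν (mk_spanSupport_le hν T x)
      fun t _ => mk_spanSupport_le hν U t)
  have hspan : closedSpan (k := k) (⋃ x ∈ S, spanSupport k T x) = closedSpan (k := k) S := by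
    refine le_antisymm (closedSpan_le_closedSpan (Set.iUnion₂_subset fun x hx t ht => ?_))
      (closedSpan_le_closedSpan (subset_closedSpan_biUnion_spanSupport (hSU.trans hUT)))
    exact closedSpan_mono
      ((Set.subset_biUnion_of_mem (u := spanSupport k U) ht).trans (hclosed x hx))
      (mem_closedSpan_spanSupport (hTU' (spanSupport_subset T x ht)))
  have hrel := hT.isRelSubfree_of_subset (T₁ := ⋃ x ∈ S, spanSupport k T x)
    (Set.iUnion₂_subset fun x _ => spanSupport_subset T x)
  rw [hspan, hTU] at hrel
  exact ⟨S, hX₀S, hSν, hW S (hrel.restrict (closedSpan_mono Set.subset_union_left)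
    (closedSpan_mono (Set.union_subset hSU hWS)))⟩

variable (k) in
/-- `B` is an orthonormal set of cardinality at most `ν`, such that every extension of
`closedSpan B` by at most `ν` generators is subfree relative to `closedSpan B`. -/
structure IsSaturated (ν : Cardinal.{v}) (B : Set V) : Prop where
  isOrthonormalSet : IsOrthonormalSet k B
  mk_le : #B ≤ ν
  isRelSubfree : ∀ X : Set V, #X ≤ ν →
    IsRelSubfree (closedSpan (k := k) B) (closedSpan (k := k) (B ∪ X))

theorem IsCardFree.isSaturated_empty (h : IsCardFree k V κ) (hνκ : ν < κ) :
    IsSaturated k ν (∅ : Set V) where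
  isOrthonormalSet := .empty
  mk_le := by simp
  isRelSubfree X hX := by
    rw [closedSpan_empty, Set.empty_union]
    exact isRelSubfree_bot_of_isFree_closedSpan (h X (hX.trans_lt hνκ))

end Singular

section Interlacing

variable {k : Type u} [NormedField k] {V : Type v} [NormedAddCommGroup V] [NormedSpace k V]
  {ι : Type v} [Preorder ι]

variable (k) in
/-- The vectors which the `i`-th member of the family succeeding `f` has to span when a sequence
of families of sets is built so that its union satisfies the splitting condition of
`exists_isOrthonormalSet_of_filtration` and its `i`-th member spans `Y i`. -/
def interlacingSet (Y f : ι → Set V) (i : ι) : Set V :=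
  Y i ∪ ((⋃ j < i, f j) ∪ ⋃ j, ⋃ b ∈ f i, spanSupport k (f j) b)

theorem mk_interlacingSet_le {ν : ι → Cardinal.{v}} {Y : ι → Set V} (hmono : Monotone ν)
    (hν : ∀ i, ℵ₀ ≤ ν i) (hιν : ∀ i, #ι ≤ ν i) (hY : ∀ i, #(Y i) ≤ ν i) {f : ι → Set V}
    (hf : ∀ i, #(f i) ≤ ν i) (i : ι) : #(interlacingSet k Y f i) ≤ ν i := by
  refine mk_union_le_of_le (hν i) (hY i) (mk_union_le_of_le (hν i) ?_ ?_)
  · exact mk_biUnion_le_of_forall_le (s := Set.Iio i) (hν i) ((mk_set_le _).trans (hιν i))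
      fun j hj => (hf j).trans (hmono (le_of_lt hj))
  · rw [← Set.biUnion_univ]
    exact mk_biUnion_le_of_forall_le (hν i) ((mk_set_le _).trans (hιν i)) fun j _ =>
      mk_biUnion_le_of_forall_le (hν i) (hf i) fun b _ => mk_spanSupport_le (hν i) _ b

end Interlacing

section SingularNontrivial

variable {k : Type u} [NontriviallyNormedField k] [IsUltrametricDist k] [CompleteSpace k]
  {V : Type v} [NormedAddCommGroup V] [NormedSpace k V]

theorem IsSaturated.exists_extend [IsUltrametricDist V] [CompleteSpace V] {κ ν : Cardinal.{v}}
    {B X : Set V} (hB : IsSaturated k ν B) (h : IsCardFree k V κ) (hν : ℵ₀ ≤ ν)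
    (hνκ : Order.succ ν < κ) (hX : #X ≤ ν) :
    ∃ B', B ⊆ B' ∧ IsSaturated k ν B' ∧ X ⊆ closedSpan (k := k) B' := by
  obtain ⟨S, hBXS, hSν, hS⟩ :=
    h.exists_saturated_superset hν hνκ (mk_union_le_of_le hν hB.mk_le hX)
  have hBS : B ⊆ S := Set.subset_union_left.trans hBXS
  obtain ⟨I, φ, hφ⟩ := hB.isRelSubfree S hSν
  rw [Set.union_eq_self_of_subset_left hBS] at hφ
  obtain ⟨B', hBB', hB', heq⟩ := hφ.exists_extend (isClosed_closedSpan S) hB.isOrthonormalSet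
  have hSB' : S ⊆ closedSpan (k := k) B' := heq ▸ subset_closedSpan S
  refine ⟨B', hBB', ⟨hB', hB'.mk_le hν heq hSν, fun Y hY => ?_⟩,
    (Set.subset_union_right.trans hBXS).trans hSB'⟩
  rw [heq]
  refine (hS Y hY).restrict (heq ▸ closedSpan_mono Set.subset_union_left)
    (closedSpan_le_closedSpan (Set.union_subset ?_ ?_))
  · exact (heq ▸ subset_closedSpan B').trans (closedSpan_mono Set.subset_union_left)
  · exact Set.subset_union_right.trans (subset_closedSpan (S ∪ Y))

variable {ι : Type v} [LinearOrder ι] {ν : ι → Cardinal.{v}} {Y : ι → Set V}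
  [IsUltrametricDist V] [CompleteSpace V] {κ : Cardinal.{v}}

theorem IsCardFree.exists_seq_isSaturated (h : IsCardFree k V κ) (hmono : Monotone ν)
    (hν : ∀ i, ℵ₀ ≤ ν i) (hιν : ∀ i, #ι ≤ ν i) (hνκ : ∀ i, Order.succ (ν i) < κ)
    (hY : ∀ i, #(Y i) ≤ ν i) :
    ∃ G : ℕ → ι → Set V, (∀ n i, IsSaturated k (ν i) (G n i)) ∧ Monotone G ∧
      ∀ n i, interlacingSet k Y (G n) i ⊆ closedSpan (k := k) (G (n + 1) i) := by
  have hnext (f : {f : ι → Set V // ∀ i, IsSaturated k (ν i) (f i)}) :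
      ∃ g : {g : ι → Set V // ∀ i, IsSaturated k (ν i) (g i)}, f.1 ≤ g.1 ∧
        ∀ i, interlacingSet k Y f.1 i ⊆ closedSpan (k := k) (g.1 i) := by
    choose g hfg hg hgX using fun i => (f.2 i).exists_extend h (hν i) (hνκ i)
      (mk_interlacingSet_le (k := k) hmono hν hιν hY (fun i => (f.2 i).mk_le) i)
    exact ⟨⟨g, hg⟩, hfg, hgX⟩
  choose next hle hsub using hnext
  let G (n : ℕ) := next^[n]
    ⟨fun _ => ∅, fun i => h.isSaturated_empty ((Order.le_succ _).trans_lt (hνκ i))⟩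
  have hG (n) : G (n + 1) = next (G n) := Function.iterate_succ_apply' _ _ _
  refine ⟨fun n => (G n).1, fun n => (G n).2, monotone_nat_of_le_succ fun n => ?_, fun n i => ?_⟩
  · exact hG n ▸ hle (G n)
  · simpa only [hG] using hsub (G n) i

theorem IsCardFree.exists_filtration (h : IsCardFree k V κ) (hmono : Monotone ν)
    (hν : ∀ i, ℵ₀ ≤ ν i) (hιν : ∀ i, #ι ≤ ν i) (hνκ : ∀ i, Order.succ (ν i) < κ)
    (hY : ∀ i, #(Y i) ≤ ν i) :
    ∃ B : ι → Set V, (∀ i, IsOrthonormalSet k (B i)) ∧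
      (∀ i, Y i ⊆ closedSpan (k := k) (B i)) ∧
      ∀ i j, i < j → B i ⊆ closedSpan (k := k) (B j ∩ closedSpan (k := k) (B i)) := by
  obtain ⟨G, hG, hGmono, hGsub⟩ := h.exists_seq_isSaturated hmono hν hιν hνκ hY
  have hGle (n i) : G n i ⊆ ⋃ n, G n i := Set.subset_iUnion (fun n => G n i) n
  refine ⟨fun i => ⋃ n, G n i, fun i => .iUnion (Monotone.directed_le fun m n hmn => hGmono hmn i)
    fun n => (hG n i).isOrthonormalSet, fun i => ?_, fun i j hij => Set.iUnion_subset fun n => ?_⟩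
  · exact (Set.subset_union_left.trans (hGsub 0 i)).trans (closedSpan_mono (hGle 1 i))
  · have hspan : G n i ⊆ closedSpan (k := k) (G (n + 1) j) := fun b hb =>
      hGsub n j (.inr (.inl (Set.mem_biUnion (s := Set.Iio j) hij hb)))
    intro b hb
    have hsupp : spanSupport k (G (n + 1) j) b ⊆ closedSpan (k := k) (G (n + 2) i) := fun x hx =>
      hGsub (n + 1) i (.inr (.inr (Set.mem_iUnion.2
        ⟨j, Set.mem_biUnion (hGmono n.le_succ i hb) hx⟩)))
    exact closedSpan_mono (Set.subset_inter ((spanSupport_subset _ b).trans (hGle (n + 1) j))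
      (hsupp.trans (closedSpan_mono (hGle (n + 2) i)))) (mem_closedSpan_spanSupport (hspan hb))

theorem IsCardFree.isFree_of_isSingular {G : Set V} (hG : closedSpan (k := k) G = ⊤)
    (hsing : (#G).IsSingular) (h : IsCardFree k V #G) : IsFree k V := by
  obtain ⟨ι, _, _, ν, Y, hmono, hν, hιν, hνlt, hY, hYG⟩ := exists_cofinal_family_of_isSingular hsing
  obtain ⟨B, hB, hYB, hsplit⟩ := h.exists_filtration (Y := fun i => (↑) '' Y i) hmono hν hιν
    (fun i => hsing.isSuccLimit.succ_lt (hνlt i)) fun i => mk_image_le.trans (hY i)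
  obtain ⟨D, hD, hBD⟩ := exists_isOrthonormalSet_of_filtration hB hsplit
  refine isFree_iff.2 ⟨D, hD, top_le_iff.1 (hG ▸ closedSpan_le_closedSpan fun x hx => ?_)⟩
  obtain ⟨i, hi⟩ := Set.mem_iUnion.1 (hYG ▸ Set.mem_univ (⟨x, hx⟩ : G))
  exact closedSpan_le_closedSpan (hBD i) (hYB i ⟨_, hi, rfl⟩)

end SingularNontrivial

end UltraBanach

theorem theorem5p1_general (k : Type u) [NormedField k] [IsUltrametricDist k] [CompleteSpace k]
    (V : Type v) [NormedAddCommGroup V] [NormedSpace k V] [IsUltrametricDist V] [CompleteSpace V]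
    (hcompact : UltraBanach.IsStronglyCompactCard
      (Cardinal.lift.{v} (UltraBanach.lambdaCard k)) (Cardinal.lift.{u} (UltraBanach.rank k V))) :
    UltraBanach.IsFree k V ↔ UltraBanach.IsAlmostFree k V := by
  have hω : ℵ₀ < UltraBanach.rank k V := by
    have hlam : ℵ₀ < UltraBanach.lambdaCard k := Order.lt_succ_of_le (le_max_right _ _)
    simpa using (lift_lt.{u, v}.2 hlam).trans_le hcompact.1
  by_cases hk : ∃ c : k, 1 < ‖c‖
  · let _ : NontriviallyNormedField k := { ‹NormedField k› with non_trivial := hk }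
    obtain ⟨G, hG, hGrank⟩ := UltraBanach.exists_closedSpan_eq_top_mk_eq_rank (k := k) (V := V)
    refine ⟨fun h S _ => h.isFree_closedSpan S, fun h => ?_⟩
    rw [UltraBanach.IsAlmostFree, ← hGrank] at h
    rw [← hGrank] at hcompact hω
    rcases isRegular_or_isSingular hω.le with hreg | hsing
    · exact h.isFree_of_isRegular hG hcompact hreg
    · exact h.isFree_of_isSingular hG hsing
  · exact UltraBanach.isFree_iff_isAlmostFree_of_trivial (by push Not at hk; exact hk)
      (one_lt_aleph0.trans hω)

theorem theorem5p1 (k : Type u) [NormedField k] [IsUltrametricDist k] [CompleteSpace k]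
    (V : Type v) [NormedAddCommGroup V] [NormedSpace k V] [IsUltrametricDist V] [CompleteSpace V]
    (hcard : #V = UltraBanach.rank k V)
    (hcompact : UltraBanach.IsStronglyCompactCard
      (Cardinal.lift.{v} (UltraBanach.lambdaCard k)) (Cardinal.lift.{u} (UltraBanach.rank k V))) :
    UltraBanach.IsFree k V ↔ UltraBanach.IsAlmostFree k V :=
  theorem5p1_general k V hcompact
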